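/- Let $W$ be a positive random variable with $\mathbb E[W^2]<\infty$. For each $n\in\mathbb N$ consider the generalised random graph on the vertex set $[n]=\{1,\dots,n\}$: the vertices carry weights $W_1,\dots,W_n$ which are i.i.d. copies of $W$ and, conditionally on the weights, any two distinct vertices $i,j$ are connected by an edge, independently over all pairs, with probability $$\frac{W_iW_j}{W_iW_j+L_n},\qquad L_n=\sum_{l=1}^nW_l .$$ For $A\subseteq\{3,4,\dots\}$ let $\mathcal C_n(A)$ be the number of cycles in this graph whose length lies in $A$, so that $\mathcal C_n$ is a point process on $\{3,4,\dots\}$. Let $\eta$ be a Poisson point process on $\{3,4,\dots\}$ whose intensity measure $\lambda$ is given by $$\lambda(\{k\})=\lambda_k=\frac1{2k}\left(\frac{\mathbb E[W^2]}{\mathbb E[W]}\right)^k,\qquad k\ge 3 .$$ Then, as $n\to\infty$, $\mathcal C_n$ converges in distribution to $\eta$ with respect to the vague topology on the set of locally finite counting measures on $\{3,4,\dots\}$ (the coarsest topology for which $\mu\mapsto\int f\,d\mu$ is continuous for every finitely supported $f:\{3,4,\dots\}\to\mathbb R$). Equivalently, for every finite set $A\subseteq\{3,4,\dots\}$ the random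 vector $(\mathcal C_n(\{k\}))_{k\in A}$ converges in distribution to a vector of independent Poisson random variables with parameters $\lambda_k$, $k\in A$. -/

import Mathlib

open MeasureTheory ProbabilityTheory Filter Topology
open scoped ENNReal CompactlySupported

/-- The set `{3, 4, …}` of possible cycle lengths, with the discrete topology and the discrete
`σ`-algebra inherited from `ℕ`. -/
abbrev CycleLength : Type := {k : ℕ // 3 ≤ k}

/-! ### Counting measures on `{3, 4, …}` and the vague topology -/

/-- A (locally finite) counting measure on `{3, 4, …}`: a measure which takes values in
`{0, 1, 2, …}` on every bounded set, that is, on every finite set. -/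
structure CountingMeasure : Type where
  toMeasure : Measure CycleLength
  integerValued : ∀ B : Set CycleLength, B.Finite → ∃ m : ℕ, toMeasure B = m

namespace CountingMeasure

/-- The vague topology: the coarsest topology for which `μ ↦ ∫ f dμ` is continuous for every
continuous function `f` with compact support. -/
noncomputable instance : TopologicalSpace CountingMeasure :=
  TopologicalSpace.induced
    (fun (μ : CountingMeasure) (f : C_c(CycleLength, ℝ)) => ∫ k, f k ∂μ.toMeasure) inferInstance

/-- The Borel `σ`-algebra of the vague topology. -/
noncomputable instance : MeasurableSpace CountingMeasure := borel CountingMeasure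

instance : BorelSpace CountingMeasure := ⟨rfl⟩

/-- The counting measure `∑ k, c k • δ_k` which gives mass `c k` to the point `k`. -/
noncomputable def ofCounts (c : CycleLength → ℕ) : CountingMeasure where
  toMeasure := Measure.sum fun k => (c k : ℝ≥0∞) • Measure.dirac k
  integerValued := by
    intro B hB
    refine ⟨∑ k ∈ hB.toFinset, c k, ?_⟩
    rw [Measure.sum_apply _ (MeasurableSet.of_discrete), tsum_eq_sum (s := hB.toFinset)]
    · push_cast
      refine Finset.sum_congr rfl fun k hk => ?_
      have hk' : k ∈ B := by simpa using hk
      simp [hk']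
    · intro k hk
      have hk' : k ∉ B := by simpa using hk
      simp [hk']

end CountingMeasure

/-- `η` is a Poisson point process on `{3, 4, …}` with intensity measure `Λ`: the mass `η(B)` is
Poisson distributed with parameter `Λ(B)` for every `B` with `Λ(B) < ∞`, and the masses of
finitely many pairwise disjoint sets are independent. -/
structure IsPoissonPointProcess {Ω : Type*} [MeasurableSpace Ω] (η : Ω → CountingMeasure)
    (Λ : Measure CycleLength) (P : Measure Ω) : Prop where
  aemeasurable : AEMeasurable η P
  hasLaw : ∀ B : Set CycleLength, Λ B ≠ ∞ →
    HasLaw (fun ω => (η ω).toMeasure B)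
      ((poissonMeasure (Λ B).toNNReal).map (Nat.cast : ℕ → ℝ≥0∞)) P
  indep : ∀ (m : ℕ) (B : Fin m → Set CycleLength), Pairwise (Function.onFun Disjoint B) →
    iIndepFun (fun i ω => (η ω).toMeasure (B i)) P

/-! ### The generalised random graph -/

/-- The connection probability `w i * w j / (w i * w j + L)`, `L` being the sum of all weights. -/
noncomputable def connectionProb {n : ℕ} (w : Fin n → ℝ) (i j : Fin n) : ℝ :=
  w i * w j / (w i * w j + ∑ l, w l)

/-- `G` is a generalised random graph on `n` vertices with vertex weights `w`: the weights are
i.i.d. copies of the random variable `W₀`, and conditionally on the weights distinct vertices `i`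
and `j` are connected with probability `connectionProb w i j`, independently over all edges. -/
structure IsGeneralisedRandomGraph {Ω₀ Ω : Type*} [MeasurableSpace Ω₀] [MeasurableSpace Ω]
    (W₀ : Ω₀ → ℝ) (P₀ : Measure Ω₀) {n : ℕ} (w : Fin n → Ω → ℝ)
    (G : Ω → SimpleGraph (Fin n)) (P : Measure Ω) : Prop where
  measurable_weight : ∀ i, Measurable (w i)
  identDistrib : ∀ i, IdentDistrib (w i) W₀ P P₀
  indep_weight : iIndepFun w P
  measurable_graph : ∀ i j, MeasurableSet {ω | (G ω).Adj i j}
  /-- The conditional connection probabilities given the weights. -/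
  condProb_edge : ∀ i j, i ≠ j →
    P⟦{ω | (G ω).Adj i j} | MeasurableSpace.comap (fun ω l => w l ω) MeasurableSpace.pi⟧
      =ᵐ[P] fun ω => connectionProb (fun l => w l ω) i j
  /-- The edges are conditionally independent given the weights. -/
  condIndep_edge : ∀ S : Finset (Sym2 (Fin n)), (∀ e ∈ S, ¬ e.IsDiag) →
    P⟦⋂ e ∈ S, {ω | e ∈ (G ω).edgeSet} |
        MeasurableSpace.comap (fun ω l => w l ω) MeasurableSpace.pi⟧
      =ᵐ[P] ∏ e ∈ S, P⟦{ω | e ∈ (G ω).edgeSet} |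
        MeasurableSpace.comap (fun ω l => w l ω) MeasurableSpace.pi⟧

/-! ### Cycle counts -/

/-- The tuples of `k` distinct vertices which represent the possible cycles of length `k`. The
starting vertex is the smallest one, and its two neighbours in the cycle are ordered, so that every
cycle is represented by exactly one tuple. -/
def IsCycleLabel {n : ℕ} (k : CycleLength) (α : Fin k → Fin n) : Prop :=
  Function.Injective α ∧ (∀ i, α ⟨0, by have := k.2; omega⟩ ≤ α i) ∧
    α ⟨1, by have := k.2; omega⟩ < α ⟨k - 1, by have := k.2; omega⟩

open Classical in
/-- The number of cycles of length `k` in the graph `G`. Here `finRotate k` is the cyclic shift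
`0 ↦ 1 ↦ ⋯ ↦ k - 1 ↦ 0`. -/
noncomputable def cycleCount {n : ℕ} (G : SimpleGraph (Fin n)) (k : CycleLength) : ℕ :=
  (Finset.univ.filter fun α : Fin k → Fin n =>
    IsCycleLabel k α ∧ ∀ i, G.Adj (α i) (α (finRotate k i))).card

/-- The cycle-count process of `G`: the counting measure on `{3, 4, …}` which gives to a set `A`
the number of cycles of `G` whose length lies in `A`. -/
noncomputable def cycleProcess {n : ℕ} (G : SimpleGraph (Fin n)) : CountingMeasure :=
  CountingMeasure.ofCounts (cycleCount G)

/-! ### The limit -/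

/-- `λ_k = (E[W²] / E[W]) ^ k / (2 k)`. -/
noncomputable def cycleRate {Ω₀ : Type*} [MeasurableSpace Ω₀] (W₀ : Ω₀ → ℝ) (P₀ : Measure Ω₀)
    (k : CycleLength) : ℝ :=
  1 / (2 * (k : ℝ)) * ((∫ ω, W₀ ω ^ 2 ∂P₀) / ∫ ω, W₀ ω ∂P₀) ^ (k : ℕ)

/-- The measure on `{3, 4, …}` which gives mass `λ_k` to the point `k`. -/
noncomputable def cycleIntensity {Ω₀ : Type*} [MeasurableSpace Ω₀] (W₀ : Ω₀ → ℝ)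
    (P₀ : Measure Ω₀) : Measure CycleLength :=
  Measure.sum fun k => ENNReal.ofReal (cycleRate W₀ P₀ k) • Measure.dirac k

/-! The proof conditions on the weights and shows that the conditional characteristic function of
the cycle counts converges to that of independent Poisson variables.

Fix the weights and put `x v = w v / √L`, so that the connection probability of `u` and `v` is
`x u * x v / (1 + x u * x v)`. For complex numbers `t k` with `‖1 - t k‖ ≤ 1`, the generating
function of the cycle counts is the expectation of a product of factors
`1 - t k * 1{α is present}` over all possible cycles `α`. Inserting these factors one at a time,
and each time dropping the earlier factors whose cycles share an edge with the new one, shows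
that the expectation of the product is close to the product of the expectations
(`norm_integral_prod_one_sub_sub_le`). The error is at most a multiple of the expected number of
pairs of distinct cycles which share an edge. In the union of such a pair all degrees are at
least two and some degree is at least three (`IsCycleLabel.eq_of_cycleEdges_eq`,
`exists_three_le_card_filter_mem`), so the probability that the pair is present is at most
`max x` times the product of `x v ^ 2` over the vertices covered by it. Summing over vertex sets
gives the bound `C * max x * exp (∑ x v ^ 2)` for the error (`sum_overlapping_le`). The expected
number of `k`-cycles is asymptotically `(∑ x v ^ 2) ^ k / (2 * k)`, because each cycle
corresponds to `2 * k` injective tuples and non-injective tuples are negligible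
(`tendsto_sum_prod_cycleEdges`).

Only `∑ x v ^ 2 = ∑ w v ^ 2 / ∑ w v → E[W²] / E[W]` and `max x → 0` are needed of the weights.
The law of the weights of the `n`-th graph is that of the first `n` terms of one i.i.d. sequence,
for which both hold almost surely by the strong law of large numbers; dominated convergence then
removes the conditioning (`tendsto_integral_prod_edgeConfig`). Lévy's convergence theorem gives
the joint convergence of finitely many cycle counts. This implies convergence for the vague
topology since a vaguely open set is an increasing union of sets which depend on finitely many
counts only (`tendstoInDistribution_countingMeasure`). -/

open scoped unitInterval

/-! ### Independent edge configurations -/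

section EdgeConfigurations

variable {E : Type*}

/-- The law of a random subset of `E`, encoded by its Boolean indicator, which contains each
element `e` with probability `p e`, independently over `e`. -/
noncomputable def configMeasure [Fintype E] (p : E → I) : Measure (E → Bool) :=
  Measure.pi fun e => bernoulliMeasure true false (p e)

instance [Fintype E] (p : E → I) : IsProbabilityMeasure (configMeasure p) := by
  unfold configMeasure; infer_instance

/-- The indicator that every element of `S` is present in the configuration `c`. -/
def allOpen (S : Finset E) (c : E → Bool) : ℂ := ∏ e ∈ S, if c e then 1 else 0

lemma allOpen_eq_ite (S : Finset E) (c : E → Bool) [Decidable (∀ e ∈ S, c e = true)] :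
    allOpen S c = if ∀ e ∈ S, c e = true then 1 else 0 := by
  unfold allOpen
  rw [Finset.prod_ite_zero]
  simp

lemma allOpen_eq_zero_or_one (S : Finset E) (c : E → Bool) : allOpen S c = 0 ∨ allOpen S c = 1 := by
  classical
  rw [allOpen_eq_ite]; split_ifs <;> simp

lemma norm_allOpen_le (S : Finset E) (c : E → Bool) : ‖allOpen S c‖ ≤ 1 := by
  rcases allOpen_eq_zero_or_one S c with h | h <;> simp [h]

lemma integral_configMeasure [Fintype E] [DecidableEq E] (p : E → I) (g : (E → Bool) → ℂ) :
    ∫ c, g c ∂configMeasure p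
      = ∑ c, (∏ e, if c e then ((p e : ℝ) : ℂ) else 1 - ((p e : ℝ) : ℂ)) * g c := by
  rw [integral_fintype Integrable.of_finite]
  refine Finset.sum_congr rfl fun c _ => ?_
  have : (configMeasure p).real {c} = ∏ e, if c e then (p e : ℝ) else 1 - (p e : ℝ) := by
    rw [configMeasure, Measure.real, Measure.pi_singleton, ENNReal.toReal_prod]
    refine Finset.prod_congr rfl fun e _ => ?_
    change (bernoulliMeasure true false (p e)).real {c e} = _
    cases h : c e <;> simp
  rw [this, Complex.real_smul]
  push_cast
  congr 1
  refine Finset.prod_congr rfl fun e _ => ?_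
  split_ifs <;> simp

lemma integral_allOpen [Fintype E] (p : E → I) (S : Finset E) :
    ∫ c, allOpen S c ∂configMeasure p = ∏ e ∈ S, ((p e : ℝ) : ℂ) := by
  classical
  have h : ∀ c : E → Bool, allOpen S c
      = ∏ e, (fun e (b : Bool) => if e ∈ S then (if b then (1 : ℂ) else 0) else 1) e (c e) := by
    intro c
    simp only [allOpen]
    rw [Finset.prod_ite_mem, Finset.univ_inter]
  rw [integral_congr_ae (ae_of_all _ h), configMeasure,
    integral_fintype_prod_eq_prod fun e (b : Bool) =>
      if e ∈ S then (if b then (1 : ℂ) else 0) else 1]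
  rw [← Finset.univ_inter S, ← Finset.prod_ite_mem]
  refine Finset.prod_congr rfl fun e _ => ?_
  rw [integral_fintype Integrable.of_finite]
  simp

/-- The event that all elements of `S` are present is independent of everything that does not look
at `S`. -/
lemma integral_allOpen_mul [Fintype E] [DecidableEq E] (p : E → I) (S : Finset E)
    (g : (E → Bool) → ℂ) (hg : ∀ c c' : E → Bool, (∀ e ∉ S, c e = c' e) → g c = g c') :
    ∫ c, allOpen S c * g c ∂configMeasure p
      = (∏ e ∈ S, ((p e : ℝ) : ℂ)) * ∫ c, g c ∂configMeasure p := by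
  have hind : iIndepFun (fun (e : E) (c : E → Bool) => c e) (configMeasure p) :=
    iIndepFun_pi (X := fun _ b => b) (fun _ => by fun_prop)
  have h2 := hind.indepFun_finset S Sᶜ disjoint_compl_right (fun e => measurable_pi_apply e)
  let φ : (S → Bool) → ℂ := fun d => ∏ e : S, if d e then 1 else 0
  let ψ : ((Sᶜ : Finset E) → Bool) → ℂ :=
    fun d => g fun e => if h : e ∈ Sᶜ then d ⟨e, h⟩ else false
  have hφ : ∀ c : E → Bool, φ (fun i => c i) = allOpen S c := by
    intro c
    simp only [φ, allOpen]
    rw [Finset.prod_coe_sort S fun e => if c e = true then (1 : ℂ) else 0]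
  have hψ : ∀ c : E → Bool, ψ (fun i => c i) = g c := by
    intro c
    refine hg _ _ fun e he => ?_
    simp [he]
  have h3 := h2.integral_comp_mul_comp (f := φ) (g := ψ)
    Measurable.of_discrete.aemeasurable Measurable.of_discrete.aemeasurable
    (StronglyMeasurable.of_discrete).aestronglyMeasurable
    (StronglyMeasurable.of_discrete).aestronglyMeasurable
  simp only [Pi.mul_apply, Function.comp_def, hφ, hψ] at h3
  rw [← integral_allOpen, ← h3]

end EdgeConfigurations

/-! ### Decoupling products of indicators -/

lemma norm_prod_sub_one_le {ι : Type*} (s : Finset ι) (z : ι → ℂ) (hz : ∀ i ∈ s, ‖z i‖ ≤ 1) :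
    ‖∏ i ∈ s, z i - 1‖ ≤ ∑ i ∈ s, ‖z i - 1‖ := by
  classical
  induction s using Finset.induction_on with
  | empty => simp
  | insert j s hj ih =>
    rw [Finset.prod_insert hj, Finset.sum_insert hj]
    have h1 : z j * ∏ i ∈ s, z i - 1 = z j * (∏ i ∈ s, z i - 1) + (z j - 1) := by ring
    rw [h1]
    refine (norm_add_le _ _).trans ?_
    rw [norm_mul, add_comm]
    have := ih fun i hi => hz i (Finset.mem_insert_of_mem hi)
    have h2 := hz j (Finset.mem_insert_self _ _)
    have h3 := norm_nonneg (∏ i ∈ s, z i - 1)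
    nlinarith

lemma norm_prod_le_one_of_norm_le_one {ι : Type*} (s : Finset ι) (z : ι → ℂ)
    (hz : ∀ i ∈ s, ‖z i‖ ≤ 1) : ‖∏ i ∈ s, z i‖ ≤ 1 := by
  rw [norm_prod]
  exact Finset.prod_le_one (fun _ _ => norm_nonneg _) hz

lemma norm_prod_sub_prod_le_sum {ι : Type*} (s : Finset ι) (a b : ι → ℂ)
    (ha : ∀ i ∈ s, ‖a i‖ ≤ 1) (hb : ∀ i ∈ s, ‖b i‖ ≤ 1) :
    ‖∏ i ∈ s, a i - ∏ i ∈ s, b i‖ ≤ ∑ i ∈ s, ‖a i - b i‖ := by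
  classical
  induction s using Finset.induction_on with
  | empty => simp
  | insert j s hj ih =>
    rw [Finset.prod_insert hj, Finset.prod_insert hj, Finset.sum_insert hj]
    have h1 : a j * ∏ i ∈ s, a i - b j * ∏ i ∈ s, b i
        = (a j - b j) * ∏ i ∈ s, a i + b j * (∏ i ∈ s, a i - ∏ i ∈ s, b i) := by ring
    rw [h1]
    refine (norm_add_le _ _).trans ?_
    rw [norm_mul, norm_mul]
    have h2 := ih (fun i hi => ha i (Finset.mem_insert_of_mem hi))
      (fun i hi => hb i (Finset.mem_insert_of_mem hi))
    have h3 := hb j (Finset.mem_insert_self _ _)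
    have h4 := norm_prod_le_one_of_norm_le_one s a
      (fun i hi => ha i (Finset.mem_insert_of_mem hi))
    have h5 := norm_nonneg (a j - b j)
    have h6 := norm_nonneg (∏ i ∈ s, a i - ∏ i ∈ s, b i)
    nlinarith

/-- `1 - t * r` is a convex combination of `1` and `1 - t`. -/
lemma norm_one_sub_mul_le_one {t : ℂ} (ht : ‖1 - t‖ ≤ 1) {r : ℝ} (h0 : 0 ≤ r) (h1 : r ≤ 1) :
    ‖1 - t * r‖ ≤ 1 := by
  have h : 1 - t * r = ((1 - r : ℝ) : ℂ) + (r : ℂ) * (1 - t) := by push_cast; ring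
  rw [h]
  refine (norm_add_le _ _).trans ?_
  rw [norm_mul, Complex.norm_real, Complex.norm_real, Real.norm_of_nonneg h0,
    Real.norm_of_nonneg (by linarith)]
  nlinarith

lemma norm_le_two_of_norm_one_sub_le {t : ℂ} (ht : ‖1 - t‖ ≤ 1) : ‖t‖ ≤ 2 := by
  have h : t = 1 - (1 - t) := by ring
  rw [h]
  refine (norm_sub_le _ _).trans ?_
  simp only [norm_one]; linarith

section Decoupling

variable {E J : Type*} [Fintype E] [DecidableEq E]

/-- Adding one factor `1 - t j * allOpen (S j)` to the product: after dropping from the product the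
factors which share an element with `S j`, the new factor is independent of the rest. -/
lemma norm_integral_allOpen_mul_prod_sub_le (p : E → I) (S : J → Finset E) (t : J → ℂ)
    (ht : ∀ j, ‖1 - t j‖ ≤ 1) (s : Finset J) (j : J) :
    ‖∫ c, allOpen (S j) c * ∏ i ∈ s, (1 - t i * allOpen (S i) c) ∂configMeasure p
        - (∏ e ∈ S j, ((p e : ℝ) : ℂ))
          * ∫ c, ∏ i ∈ s, (1 - t i * allOpen (S i) c) ∂configMeasure p‖
      ≤ 4 * ∑ i ∈ s.filter (fun i => ¬ Disjoint (S i) (S j)), ∏ e ∈ S i ∪ S j, (p e : ℝ) := by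
  set μ := configMeasure p
  set X : (E → Bool) → ℂ := fun c => ∏ i ∈ s, (1 - t i * allOpen (S i) c) with hX
  set N := s.filter (fun i => ¬ Disjoint (S i) (S j)) with hN
  set Y : (E → Bool) → ℂ := fun c =>
    ∏ i ∈ s.filter (fun i => Disjoint (S i) (S j)), (1 - t i * allOpen (S i) c) with hY
  set q : ℂ := ∏ e ∈ S j, ((p e : ℝ) : ℂ) with hq
  have hfac : ∀ i c, ‖1 - t i * allOpen (S i) c‖ ≤ 1 := by
    intro i c
    rcases allOpen_eq_zero_or_one (S i) c with h | h <;> simp [h, ht i]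
  -- `Y` keeps the factors whose sets are disjoint from `S j`; all factors have norm at most one,
  -- so the error of passing from `X` to `Y` is bounded by the indicators of the dropped sets
  have hXY : ∀ c, ‖X c - Y c‖ ≤ ∑ i ∈ N, 2 * ‖allOpen (S i) c‖ := by
    intro c
    have h1 : X c = Y c * ∏ i ∈ N, (1 - t i * allOpen (S i) c) :=
      (Finset.prod_filter_mul_prod_filter_not s _ _).symm
    have h2 : X c - Y c = Y c * (∏ i ∈ N, (1 - t i * allOpen (S i) c) - 1) := by rw [h1]; ring
    rw [h2, norm_mul]
    have h3 : ‖Y c‖ ≤ 1 := norm_prod_le_one_of_norm_le_one _ _ fun i _ => hfac i c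
    have h4 := norm_prod_sub_one_le N (fun i => 1 - t i * allOpen (S i) c) fun i _ => hfac i c
    have h5 : ∑ i ∈ N, ‖1 - t i * allOpen (S i) c - 1‖ ≤ ∑ i ∈ N, 2 * ‖allOpen (S i) c‖ := by
      refine Finset.sum_le_sum fun i _ => ?_
      rw [sub_sub_cancel_left, norm_neg, norm_mul]
      exact mul_le_mul_of_nonneg_right (norm_le_two_of_norm_one_sub_le (ht i)) (norm_nonneg _)
    have h6 := norm_nonneg (∏ i ∈ N, (1 - t i * allOpen (S i) c) - 1)
    nlinarith
  have hYind : ∫ c, allOpen (S j) c * Y c ∂μ = q * ∫ c, Y c ∂μ := by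
    refine integral_allOpen_mul p (S j) Y fun c c' h => ?_
    refine Finset.prod_congr rfl fun i hi => ?_
    have hd := (Finset.mem_filter.1 hi).2
    have : allOpen (S i) c = allOpen (S i) c' :=
      Finset.prod_congr rfl fun e he => by rw [h e (Finset.disjoint_left.1 hd he)]
    rw [this]
  have hint : ∀ f : (E → Bool) → ℂ, Integrable f μ := fun f => Integrable.of_finite
  have hintR : ∀ f : (E → Bool) → ℝ, Integrable f μ := fun f => Integrable.of_finite
  have hnorm : ∀ T : Finset E, ∫ c, ‖allOpen T c‖ ∂μ = ∏ e ∈ T, (p e : ℝ) := by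
    intro T
    have h1 : ∀ c, ((‖allOpen T c‖ : ℝ) : ℂ) = allOpen T c := fun c => by
      rcases allOpen_eq_zero_or_one T c with h | h <;> simp [h]
    have h2 := integral_allOpen p T
    rw [← integral_congr_ae (ae_of_all _ h1), integral_complex_ofReal] at h2
    exact_mod_cast h2
  have key : ∫ c, allOpen (S j) c * X c ∂μ - q * ∫ c, X c ∂μ
      = ∫ c, allOpen (S j) c * (X c - Y c) ∂μ - q * ∫ c, (X c - Y c) ∂μ := by
    simp_rw [mul_sub]
    rw [integral_sub (hint _) (hint _), integral_sub (hint _) (hint _), hYind]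
    ring
  change ‖∫ c, allOpen (S j) c * X c ∂μ - q * ∫ c, X c ∂μ‖ ≤ _
  rw [key]
  refine (norm_sub_le _ _).trans ?_
  have hA : ‖∫ c, allOpen (S j) c * (X c - Y c) ∂μ‖
      ≤ 2 * ∑ i ∈ N, ∏ e ∈ S i ∪ S j, (p e : ℝ) := by
    calc _ ≤ ∫ c, ∑ i ∈ N, 2 * ‖allOpen (S i ∪ S j) c‖ ∂μ := by
          refine norm_integral_le_of_norm_le (hintR _) (ae_of_all _ fun c => ?_)
          rw [norm_mul]
          rcases allOpen_eq_zero_or_one (S j) c with h | h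
          · rw [h]; simp only [norm_zero, zero_mul]; positivity
          · rw [h, norm_one, one_mul]
            refine (hXY c).trans (le_of_eq (Finset.sum_congr rfl fun i _ => ?_))
            classical
            rw [allOpen_eq_ite] at h
            have hj : ∀ e ∈ S j, c e = true := by
              by_contra hne; rw [if_neg hne] at h; exact zero_ne_one h
            rw [allOpen_eq_ite, allOpen_eq_ite]
            have : (∀ e ∈ S i, c e = true) ↔ ∀ e ∈ S i ∪ S j, c e = true := by
              constructor
              · intro h e he
                rcases Finset.mem_union.1 he with he | he
                exacts [h e he, hj e he]
              · exact fun h e he => h e (Finset.mem_union_left _ he)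
            simp only [this]
      _ = _ := by
          rw [integral_finsetSum _ fun i _ => hintR _, Finset.mul_sum]
          refine Finset.sum_congr rfl fun i _ => ?_
          rw [integral_const_mul, hnorm]
  have hB : ‖q * ∫ c, (X c - Y c) ∂μ‖ ≤ 2 * ∑ i ∈ N, ∏ e ∈ S i ∪ S j, (p e : ℝ) := by
    rw [norm_mul]
    have hqn : ‖q‖ = ∏ e ∈ S j, (p e : ℝ) := by
      rw [hq, norm_prod]
      exact Finset.prod_congr rfl fun e _ => by
        rw [Complex.norm_real, Real.norm_of_nonneg (p e).2.1]
    have h1 : ‖∫ c, (X c - Y c) ∂μ‖ ≤ ∑ i ∈ N, 2 * ∏ e ∈ S i, (p e : ℝ) := by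
      refine (norm_integral_le_of_norm_le (hintR _) (ae_of_all _ hXY)).trans (le_of_eq ?_)
      rw [integral_finsetSum _ fun i _ => hintR _]
      refine Finset.sum_congr rfl fun i _ => ?_
      rw [integral_const_mul, hnorm]
    rw [hqn]
    refine (mul_le_mul_of_nonneg_left h1 (Finset.prod_nonneg fun e _ => (p e).2.1)).trans ?_
    rw [Finset.mul_sum, Finset.mul_sum]
    refine Finset.sum_le_sum fun i _ => ?_
    -- the product of the two probabilities is at most the joint probability
    have h2 : (∏ e ∈ S j, (p e : ℝ)) * ∏ e ∈ S i, (p e : ℝ)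
        = (∏ e ∈ S i ∪ S j, (p e : ℝ)) * ∏ e ∈ S i ∩ S j, (p e : ℝ) := by
      rw [Finset.prod_union_inter, mul_comm]
    have h3 : ∏ e ∈ S i ∩ S j, (p e : ℝ) ≤ 1 :=
      Finset.prod_le_one (fun e _ => (p e).2.1) fun e _ => (p e).2.2
    have h4 : 0 ≤ ∏ e ∈ S i ∪ S j, (p e : ℝ) := Finset.prod_nonneg fun e _ => (p e).2.1
    nlinarith
  linarith

/-- The decoupling bound: the expectation of a product of factors `1 - t j * allOpen (S j)` is
close to the product of the expectations, up to the joint probabilities of pairs of overlapping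
sets. -/
lemma norm_integral_prod_one_sub_sub_le [DecidableEq J] (p : E → I) (S : J → Finset E) (t : J → ℂ)
    (ht : ∀ j, ‖1 - t j‖ ≤ 1) (s : Finset J) :
    ‖∫ c, ∏ j ∈ s, (1 - t j * allOpen (S j) c) ∂configMeasure p
        - ∏ j ∈ s, (1 - t j * (∏ e ∈ S j, (p e : ℝ) : ℝ))‖
      ≤ 8 * ∑ a ∈ s.offDiag with ¬ Disjoint (S a.1) (S a.2), ∏ e ∈ S a.1 ∪ S a.2, (p e : ℝ) := by
  induction s using Finset.induction_on with
  | empty => simp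
  | insert j s hj ih =>
    set μ := configMeasure p
    have hint : ∀ f : (E → Bool) → ℂ, Integrable f μ := fun f => Integrable.of_finite
    set X : (E → Bool) → ℂ := fun c => ∏ i ∈ s, (1 - t i * allOpen (S i) c) with hX
    set q : ℝ := ∏ e ∈ S j, (p e : ℝ) with hq
    have hqc : (∏ e ∈ S j, ((p e : ℝ) : ℂ)) = (q : ℂ) := by rw [hq]; push_cast; rfl
    have h0 : 0 ≤ q := Finset.prod_nonneg fun e _ => (p e).2.1
    have h1 : q ≤ 1 := Finset.prod_le_one (fun e _ => (p e).2.1) fun e _ => (p e).2.2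
    have hstep := norm_integral_allOpen_mul_prod_sub_le p S t ht s j
    rw [hqc] at hstep
    change ‖∫ c, allOpen (S j) c * X c ∂μ - q * ∫ c, X c ∂μ‖ ≤ _ at hstep
    simp_rw [Finset.prod_insert hj]
    have e1 : ∫ c, (1 - t j * allOpen (S j) c) * X c ∂μ
        = ∫ c, X c ∂μ - t j * ∫ c, allOpen (S j) c * X c ∂μ := by
      rw [← integral_const_mul, ← integral_sub (hint _) (hint _)]
      congr 1; ext c; ring
    change ‖∫ c, (1 - t j * allOpen (S j) c) * X c ∂μ - _‖ ≤ _
    set Q : ℂ := ∏ i ∈ s, (1 - t i * (∏ e ∈ S i, (p e : ℝ) : ℝ)) with hQ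
    have e2 : ∫ c, (1 - t j * allOpen (S j) c) * X c ∂μ - (1 - t j * q) * Q
        = (1 - t j * q) * (∫ c, X c ∂μ - Q)
          - t j * (∫ c, allOpen (S j) c * X c ∂μ - q * ∫ c, X c ∂μ) := by
      rw [e1]; ring
    rw [e2]
    refine (norm_sub_le _ _).trans ?_
    rw [norm_mul, norm_mul]
    have b1 := norm_one_sub_mul_le_one (ht j) h0 h1
    have b2 := norm_le_two_of_norm_one_sub_le (ht j)
    have hsum : ∑ i ∈ s.filter (fun i => ¬ Disjoint (S i) (S j)), ∏ e ∈ S i ∪ S j, (p e : ℝ)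
        + ∑ a ∈ s.offDiag with ¬ Disjoint (S a.1) (S a.2), ∏ e ∈ S a.1 ∪ S a.2, (p e : ℝ)
        ≤ ∑ a ∈ (insert j s).offDiag with ¬ Disjoint (S a.1) (S a.2),
            ∏ e ∈ S a.1 ∪ S a.2, (p e : ℝ) := by
      have himg : ∑ i ∈ s.filter (fun i => ¬ Disjoint (S i) (S j)), ∏ e ∈ S i ∪ S j, (p e : ℝ)
          = ∑ a ∈ (s.filter (fun i => ¬ Disjoint (S i) (S j))).map
              ⟨fun i => (i, j), fun _ _ h => (Prod.mk.inj h).1⟩,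
              ∏ e ∈ S a.1 ∪ S a.2, (p e : ℝ) := by
        rw [Finset.sum_map]; rfl
      rw [himg, ← Finset.sum_union]
      · refine Finset.sum_le_sum_of_subset_of_nonneg ?_ fun _ _ _ =>
          Finset.prod_nonneg fun e _ => (p e).2.1
        intro a ha
        simp only [Finset.mem_union, Finset.mem_map, Finset.mem_filter, Finset.mem_offDiag,
          Finset.mem_insert] at ha ⊢
        rcases ha with ⟨i, ⟨hi, hd⟩, rfl⟩ | ⟨⟨h1, h2, h3⟩, h4⟩
        · exact ⟨⟨Or.inr hi, Or.inl rfl, fun h => hj ((show i = j from h) ▸ hi)⟩, hd⟩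
        · exact ⟨⟨Or.inr h1, Or.inr h2, h3⟩, h4⟩
      · rw [Finset.disjoint_left]
        intro a ha ha'
        simp only [Finset.mem_map, Finset.mem_filter, Finset.mem_offDiag] at ha ha'
        obtain ⟨i, -, rfl⟩ := ha
        exact hj ha'.1.2.1
    have n1 := norm_nonneg (∫ c, X c ∂μ - Q)
    have n2 := norm_nonneg (∫ c, allOpen (S j) c * X c ∂μ - q * ∫ c, X c ∂μ)
    have m1 := mul_le_mul_of_nonneg_right b1 n1
    have m2 := mul_le_mul b2 hstep n2 zero_le_two
    linarith

end Decoupling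

/-- For small success probabilities, a product of factors `1 - t * q` is close to an
exponential. -/
lemma norm_prod_one_sub_sub_exp_le {J : Type*} (t : J → ℂ) (ht : ∀ j, ‖1 - t j‖ ≤ 1) (q : J → ℝ)
    {ε : ℝ} (hε : ε ≤ 1 / 2) (hq0 : ∀ j, 0 ≤ q j) (s : Finset J) (hq1 : ∀ j ∈ s, q j ≤ ε) :
    ‖∏ j ∈ s, (1 - t j * q j) - Complex.exp (-∑ j ∈ s, t j * q j)‖
      ≤ 4 * ε * ∑ j ∈ s, q j := by
  rw [← Finset.sum_neg_distrib, Complex.exp_sum]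
  refine (norm_prod_sub_prod_le_sum s _ _
    (fun j hj => norm_one_sub_mul_le_one (ht j) (hq0 j) ((hq1 j hj).trans (by linarith)))
    fun j _ => ?_).trans ?_
  · rw [Complex.norm_exp, Real.exp_le_one_iff]
    have h1 : 0 ≤ (t j).re := by
      have := (Complex.abs_re_le_norm (1 - t j)).trans (ht j)
      rw [Complex.sub_re, Complex.one_re, abs_le] at this
      linarith [this.2]
    simp only [Complex.neg_re, Complex.re_mul_ofReal]
    have := mul_nonneg h1 (hq0 j)
    linarith
  · rw [Finset.mul_sum]
    refine Finset.sum_le_sum fun j hj => ?_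
    have hn : ‖-(t j * q j)‖ ≤ 2 * q j := by
      rw [norm_neg, norm_mul, Complex.norm_real, Real.norm_of_nonneg (hq0 j)]
      exact mul_le_mul_of_nonneg_right (norm_le_two_of_norm_one_sub_le (ht j)) (hq0 j)
    have h2 := Complex.norm_exp_sub_one_sub_id_le (x := -(t j * q j))
      (hn.trans (by linarith [hq1 j hj]))
    rw [← norm_neg]
    have h3 : -(1 - t j * q j - Complex.exp (-(t j * q j)))
        = Complex.exp (-(t j * q j)) - 1 - -(t j * q j) := by ring
    rw [h3]
    refine h2.trans ?_
    have h4 := pow_le_pow_left₀ (norm_nonneg _) hn 2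
    have h5 := mul_le_mul_of_nonneg_right (hq1 j hj) (hq0 j)
    nlinarith

/-! ### The law of the generalised random graph -/

lemma connectionProb_comm {n : ℕ} (w : Fin n → ℝ) (i j : Fin n) :
    connectionProb w i j = connectionProb w j i := by
  simp only [connectionProb, mul_comm]

/-- The connection probability as a function on unordered pairs, truncated to `[0, 1]` so that it
is defined for arbitrary real weights, and equal to zero on the diagonal. -/
noncomputable def edgeProb {n : ℕ} (w : Fin n → ℝ) : Sym2 (Fin n) → I :=
  Sym2.lift ⟨fun i j => if i = j then 0 else Set.projIcc 0 1 zero_le_one (connectionProb w i j),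
    fun i j => by simp only [connectionProb_comm w i j, eq_comm]⟩

lemma connectionProb_mem_unitInterval {n : ℕ} {w : Fin n → ℝ} (hw : ∀ i, 0 < w i) (i j : Fin n) :
    connectionProb w i j ∈ I := by
  have h1 : 0 < w i * w j := mul_pos (hw i) (hw j)
  have h2 : 0 ≤ ∑ l, w l := Finset.sum_nonneg fun l _ => (hw l).le
  exact ⟨div_nonneg h1.le (by linarith), div_le_one_of_le₀ (by linarith) (by linarith)⟩

lemma coe_edgeProb {n : ℕ} {w : Fin n → ℝ} (hw : ∀ i, 0 < w i) {i j : Fin n} (hij : i ≠ j) :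
    (edgeProb w s(i, j) : ℝ) = connectionProb w i j := by
  simp only [edgeProb, Sym2.lift_mk, if_neg hij]
  rw [Set.projIcc_of_mem zero_le_one (connectionProb_mem_unitInterval hw i j)]

lemma edgeProb_of_isDiag {n : ℕ} (w : Fin n → ℝ) {e : Sym2 (Fin n)} (he : e.IsDiag) :
    edgeProb w e = 0 := by
  induction e with | h i j => ?_
  simp only [Sym2.mk_isDiag_iff] at he
  simp [edgeProb, he]

lemma measurable_edgeProb {n : ℕ} (e : Sym2 (Fin n)) :
    Measurable fun w : Fin n → ℝ => edgeProb w e := by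
  induction e with | h i j => ?_
  by_cases h : i = j
  · simp [edgeProb, h]
  · simp only [edgeProb, Sym2.lift_mk, if_neg h]
    refine continuous_projIcc.measurable.comp ?_
    unfold connectionProb
    fun_prop

open Classical in
/-- The edge set of a graph as a Boolean configuration on unordered pairs. -/
noncomputable def edgeConfig {V : Type*} (G : SimpleGraph V) (e : Sym2 V) : Bool :=
  decide (e ∈ G.edgeSet)

/-- Inclusion-exclusion over the absent elements. -/
lemma prod_ite_one_sub_eq_sum {E : Type*} [Fintype E] [DecidableEq E] (c : E → Bool) (x : E → ℂ) :
    ∏ e, (if c e then x e else 1 - x e)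
      = ∑ T ∈ (Finset.univ.filter fun e => ¬ c e = true).powerset,
          (-1) ^ T.card * ∏ e ∈ (Finset.univ.filter fun e => c e = true) ∪ T, x e := by
  rw [Finset.prod_ite]
  have h : ∏ e with ¬ c e = true, (1 - x e)
      = ∑ T ∈ (Finset.univ.filter fun e => ¬ c e = true).powerset,
          (-1) ^ T.card * ∏ e ∈ T, x e := by
    simp_rw [sub_eq_add_neg, Finset.prod_one_add, Finset.prod_neg]
  rw [h, Finset.mul_sum]
  refine Finset.sum_congr rfl fun T hT => ?_
  rw [Finset.prod_union]
  · ring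
  · refine Finset.disjoint_left.2 fun e he he' => ?_
    exact (Finset.mem_filter.1 (Finset.mem_powerset.1 hT he')).2 (Finset.mem_filter.1 he).2

section GraphLaw

variable {Ω₀ Ω : Type*} [MeasurableSpace Ω₀] [MeasurableSpace Ω] {W₀ : Ω₀ → ℝ} {P₀ : Measure Ω₀}
  {n : ℕ} {w : Fin n → Ω → ℝ} {G : Ω → SimpleGraph (Fin n)} {P : Measure Ω}

lemma IsGeneralisedRandomGraph.ae_pos (hG : IsGeneralisedRandomGraph W₀ P₀ w G P)
    (hW_pos : ∀ᵐ ω ∂P₀, 0 < W₀ ω) : ∀ᵐ ω ∂P, ∀ i, 0 < w i ω :=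
  ae_all_iff.2 fun i => (hG.identDistrib i).symm.ae_snd (p := fun x => 0 < x)
    measurableSet_Ioi hW_pos

lemma IsGeneralisedRandomGraph.measurableSet_mem_edgeSet
    (hG : IsGeneralisedRandomGraph W₀ P₀ w G P) (e : Sym2 (Fin n)) :
    MeasurableSet {ω | e ∈ (G ω).edgeSet} := by
  induction e with | h i j => ?_
  simpa using hG.measurable_graph i j

/-- There are only finitely many graphs, so every function of the random graph is measurable. -/
lemma IsGeneralisedRandomGraph.measurable_comp (hG : IsGeneralisedRandomGraph W₀ P₀ w G P)
    {F : Type*} [MeasurableSpace F] (f : SimpleGraph (Fin n) → F) :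
    Measurable fun ω => f (G ω) := by
  have h1 : Measurable fun ω => edgeConfig (G ω) := by
    refine measurable_pi_lambda _ fun e => measurable_to_bool ?_
    have : (fun ω => edgeConfig (G ω) e) ⁻¹' {true} = {ω | e ∈ (G ω).edgeSet} := by
      ext ω; simp [edgeConfig]
    rw [this]
    exact hG.measurableSet_mem_edgeSet e
  let r : (Sym2 (Fin n) → Bool) → SimpleGraph (Fin n) :=
    fun c => SimpleGraph.fromEdgeSet {e | c e = true}
  have h2 : ∀ ω, r (edgeConfig (G ω)) = G ω := by
    intro ω
    have : {e | edgeConfig (G ω) e = true} = (G ω).edgeSet := by ext e; simp [edgeConfig]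
    simp only [r, this, SimpleGraph.fromEdgeSet_edgeSet]
  have h3 : (fun ω => f (G ω)) = (f ∘ r) ∘ fun ω => edgeConfig (G ω) := by
    ext ω; simp [h2]
  rw [h3]
  exact Measurable.of_discrete.comp h1

variable [IsProbabilityMeasure P]

lemma IsGeneralisedRandomGraph.integrable_prod_edgeProb
    (hG : IsGeneralisedRandomGraph W₀ P₀ w G P) (S : Finset (Sym2 (Fin n))) :
    Integrable (fun ω => ∏ e ∈ S, (edgeProb (fun l => w l ω) e : ℝ)) P := by
  have hm := hG.measurable_weight
  refine Integrable.of_bound (C := 1) ?_ (ae_of_all _ fun ω => ?_)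
  · refine (Finset.measurable_prod _ fun e _ => ?_).aestronglyMeasurable
    exact measurable_subtype_coe.comp
      ((measurable_edgeProb e).comp (measurable_pi_lambda _ fun l => hm l))
  · rw [Real.norm_of_nonneg (Finset.prod_nonneg fun e _ => (edgeProb _ e).2.1)]
    exact Finset.prod_le_one (fun e _ => (edgeProb _ e).2.1) fun e _ => (edgeProb _ e).2.2

/-- The probability that a given set of edges is present, averaged over the weights. -/
lemma IsGeneralisedRandomGraph.integral_allOpen_edgeConfig
    (hG : IsGeneralisedRandomGraph W₀ P₀ w G P) (hW_pos : ∀ᵐ ω ∂P₀, 0 < W₀ ω)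
    (S : Finset (Sym2 (Fin n))) :
    ∫ ω, allOpen S (edgeConfig (G ω)) ∂P
      = ∫ ω, ∏ e ∈ S, ((edgeProb (fun l => w l ω) e : ℝ) : ℂ) ∂P := by
  classical
  by_cases hS : ∃ e ∈ S, e.IsDiag
  · obtain ⟨e, heS, he⟩ := hS
    have h1 : ∀ ω, allOpen S (edgeConfig (G ω)) = 0 := fun ω => by
      refine Finset.prod_eq_zero heS ?_
      have : e ∉ (G ω).edgeSet := fun h => (G ω).not_isDiag_of_mem_edgeSet h he
      simp [edgeConfig, this]
    have h2 : ∀ ω, ∏ e ∈ S, ((edgeProb (fun l => w l ω) e : ℝ) : ℂ) = 0 := fun ω => by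
      refine Finset.prod_eq_zero heS ?_
      simp [edgeProb_of_isDiag _ he]
    simp [h1, h2]
  push Not at hS
  set A : Set Ω := ⋂ e ∈ S, {ω | e ∈ (G ω).edgeSet} with hA
  have hle : MeasurableSpace.comap (fun ω l => w l ω) MeasurableSpace.pi
      ≤ (inferInstance : MeasurableSpace Ω) :=
    (measurable_pi_lambda _ fun l => hG.measurable_weight l).comap_le
  have h1 : ∀ ω, allOpen S (edgeConfig (G ω)) = ((A.indicator (fun _ => (1 : ℝ)) ω : ℝ) : ℂ) := by
    intro ω
    rw [allOpen_eq_ite, Set.indicator_apply]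
    have : (∀ e ∈ S, edgeConfig (G ω) e = true) ↔ ω ∈ A := by simp [hA, edgeConfig]
    simp only [this]
    split_ifs <;> simp
  rw [integral_congr_ae (ae_of_all _ h1), integral_complex_ofReal, ← integral_condExp hle,
    ← integral_complex_ofReal]
  refine integral_congr_ae ?_
  have h2 := hG.condIndep_edge S hS
  have h3 : ∀ᵐ ω ∂P, ∀ e ∈ S,
      (P⟦{ω | e ∈ (G ω).edgeSet} |
        MeasurableSpace.comap (fun ω l => w l ω) MeasurableSpace.pi⟧) ω
        = (edgeProb (fun l => w l ω) e : ℝ) := by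
    refine (Filter.eventually_all_finset S).2 fun e he => ?_
    have hd := hS e he
    induction e with | h i j => ?_
    simp only [Sym2.mk_isDiag_iff] at hd
    have h4 := hG.condProb_edge i j hd
    filter_upwards [h4, hG.ae_pos hW_pos] with ω h5 h6
    rw [coe_edgeProb h6 hd, ← h5]
    simp
  filter_upwards [h2, h3] with ω h4 h5
  rw [h4, Finset.prod_apply, Finset.prod_congr rfl h5]
  push_cast; rfl

/-- Conditionally on the weights, the edge configuration has law `configMeasure (edgeProb w)`. -/
lemma IsGeneralisedRandomGraph.integral_comp_edgeConfig
    (hG : IsGeneralisedRandomGraph W₀ P₀ w G P) (hW_pos : ∀ᵐ ω ∂P₀, 0 < W₀ ω)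
    (g : (Sym2 (Fin n) → Bool) → ℂ) :
    ∫ ω, g (edgeConfig (G ω)) ∂P
      = ∫ ω, ∫ c, g c ∂configMeasure (edgeProb fun l => w l ω) ∂P := by
  classical
  have hI : ∀ S : Finset (Sym2 (Fin n)),
      Integrable (fun ω => ∏ e ∈ S, ((edgeProb (fun l => w l ω) e : ℝ) : ℂ)) P := by
    intro S
    have := (hG.integrable_prod_edgeProb S).ofReal (𝕜 := ℂ)
    simpa using this
  have hJ : ∀ S : Finset (Sym2 (Fin n)),
      Integrable (fun ω => allOpen S (edgeConfig (G ω))) P := by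
    intro S
    refine Integrable.of_bound (C := 1) ?_ (ae_of_all _ fun ω => norm_allOpen_le _ _)
    exact (hG.measurable_comp fun H => allOpen S (edgeConfig H)).aestronglyMeasurable
  have h1 : ∀ ω, g (edgeConfig (G ω)) = ∑ c : Sym2 (Fin n) → Bool,
      (∏ e, if c e then (if edgeConfig (G ω) e then (1 : ℂ) else 0)
        else 1 - (if edgeConfig (G ω) e then (1 : ℂ) else 0)) * g c := by
    intro ω
    rw [Finset.sum_eq_single (edgeConfig (G ω))]
    · rw [Finset.prod_eq_one, one_mul]
      intro e _
      split_ifs <;> simp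
    · intro c _ hc
      obtain ⟨e, he⟩ := Function.ne_iff.1 hc
      rw [Finset.prod_eq_zero (Finset.mem_univ e), zero_mul]
      cases h : c e <;> cases h' : edgeConfig (G ω) e <;> simp_all
    · simp
  simp_rw [integral_configMeasure]
  rw [integral_congr_ae (ae_of_all _ h1)]
  simp_rw [prod_ite_one_sub_eq_sum, Finset.sum_mul]
  rw [integral_finsetSum, integral_finsetSum]
  · refine Finset.sum_congr rfl fun c _ => ?_
    rw [integral_finsetSum, integral_finsetSum]
    · refine Finset.sum_congr rfl fun T _ => ?_
      rw [integral_mul_const, integral_mul_const, integral_const_mul, integral_const_mul]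
      congr 2
      exact hG.integral_allOpen_edgeConfig hW_pos _
    · exact fun T _ => ((hI _).const_mul _).mul_const _
    · exact fun T _ => ((hJ _).const_mul _).mul_const _
  · exact fun c _ => integrable_finsetSum _ fun T _ => ((hI _).const_mul _).mul_const _
  · exact fun c _ => integrable_finsetSum _ fun T _ => ((hJ _).const_mul _).mul_const _

end GraphLaw

/-! ### Edge sets of cycles -/

section FinRotate

variable {k : ℕ}

lemma finRotate_zero_eq_one (hk : 3 ≤ k) : finRotate k ⟨0, by omega⟩ = ⟨1, by omega⟩ := by
  obtain ⟨m, rfl⟩ : ∃ m, k = m + 1 := ⟨k - 1, by omega⟩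
  exact finRotate_of_lt (by omega)

lemma finRotate_last_eq_zero (hk : 3 ≤ k) : finRotate k ⟨k - 1, by omega⟩ = ⟨0, by omega⟩ := by
  obtain ⟨m, rfl⟩ : ∃ m, k = m + 1 := ⟨k - 1, by omega⟩
  exact finRotate_last'

lemma val_finRotate (i : Fin k) : (finRotate k i : ℕ) =
    if (i : ℕ) + 1 = k then 0 else (i : ℕ) + 1 := by
  obtain ⟨m, rfl⟩ : ∃ m, k = m + 1 := ⟨k - 1, by have := i.2; omega⟩
  rw [coe_finRotate]
  simp [Fin.ext_iff]

lemma finRotate_ne_self (hk : 3 ≤ k) (i : Fin k) : finRotate k i ≠ i := by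
  intro h
  have h1 := congrArg Fin.val h
  rw [val_finRotate] at h1
  split_ifs at h1 <;> omega

lemma finRotate_finRotate_ne_self (hk : 3 ≤ k) (i : Fin k) :
    finRotate k (finRotate k i) ≠ i := by
  intro h
  have h1 := congrArg Fin.val h
  rw [val_finRotate, val_finRotate] at h1
  split_ifs at h1 <;> omega

/-- The cyclic shift acts transitively. -/
lemma forall_of_finRotate {p : Fin k → Prop} {i₀ : Fin k} (h₀ : p i₀)
    (h : ∀ i, p i → p (finRotate k i)) (i : Fin k) : p i := by
  have hz : p ⟨0, i₀.pos⟩ := by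
    by_contra hn
    have : ∀ j : ℕ, ∀ i : Fin k, (i : ℕ) + j + 1 = k → ¬ p i := by
      intro j
      induction j with
      | zero =>
        intro i hi hp
        have h1 : finRotate k i = ⟨0, i₀.pos⟩ := Fin.ext (by rw [val_finRotate, if_pos (by omega)])
        exact hn (h1 ▸ h i hp)
      | succ j ih =>
        intro i hi hp
        exact ih (finRotate k i) (by rw [val_finRotate, if_neg (by omega)]; omega) (h i hp)
    exact this (k - 1 - i₀) i₀ (by omega) h₀
  obtain ⟨j, hj⟩ := i
  induction j with
  | zero => exact hz
  | succ j ih =>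
    have h1 : finRotate k ⟨j, by omega⟩ = ⟨j + 1, hj⟩ :=
      Fin.ext (by rw [val_finRotate, if_neg (by simp; omega)])
    exact h1 ▸ h _ (ih (by omega))

end FinRotate

section CycleEdges

lemma injective_cycleEdge {V : Type*} {k : ℕ} (hk : 3 ≤ k) {α : Fin k → V}
    (hα : Function.Injective α) : Function.Injective fun i => s(α i, α (finRotate k i)) := by
  intro i j h
  rcases Sym2.eq_iff.1 h with ⟨h1, -⟩ | ⟨h1, h2⟩
  · exact hα h1
  · exfalso
    have h3 := hα h1
    have h4 := hα h2
    rw [h3] at h4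
    exact finRotate_finRotate_ne_self hk j h4

variable {V : Type*} [DecidableEq V] {k l : ℕ}

/-- The edges of the closed walk which visits the vertices `α 0, …, α (k - 1)` cyclically. -/
def cycleEdges (α : Fin k → V) : Finset (Sym2 V) :=
  Finset.univ.image fun i => s(α i, α (finRotate k i))

lemma mem_cycleEdges (α : Fin k → V) (i : Fin k) : s(α i, α (finRotate k i)) ∈ cycleEdges α :=
  Finset.mem_image_of_mem _ (Finset.mem_univ _)

lemma card_cycleEdges (hk : 3 ≤ k) {α : Fin k → V} (hα : Function.Injective α) :
    (cycleEdges α).card = k := by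
  rw [cycleEdges, Finset.card_image_of_injective _ (injective_cycleEdge hk hα)]
  simp

lemma not_isDiag_of_mem_cycleEdges (hk : 3 ≤ k) {α : Fin k → V} (hα : Function.Injective α)
    {e : Sym2 V} (he : e ∈ cycleEdges α) : ¬ e.IsDiag := by
  obtain ⟨i, -, rfl⟩ := Finset.mem_image.1 he
  rw [Sym2.mk_isDiag_iff]
  exact fun h => finRotate_ne_self hk i (hα h).symm

lemma mem_range_of_mem_cycleEdges {α : Fin k → V} {e : Sym2 V} (he : e ∈ cycleEdges α) {v : V}
    (hv : v ∈ e) : ∃ i, α i = v := by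
  obtain ⟨i, -, rfl⟩ := Finset.mem_image.1 he
  rcases Sym2.mem_iff.1 hv with rfl | rfl
  exacts [⟨_, rfl⟩, ⟨_, rfl⟩]

/-- Two distinct edges of a cycle meet at each of its vertices. -/
lemma exists_two_cycleEdges (hk : 3 ≤ k) {α : Fin k → V} (hα : Function.Injective α) (i : Fin k) :
    ∃ e ∈ cycleEdges α, ∃ e' ∈ cycleEdges α, e ≠ e' ∧ α i ∈ e ∧ α i ∈ e' := by
  refine ⟨_, mem_cycleEdges α i, _, mem_cycleEdges α ((finRotate k).symm i), fun h => ?_,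
    Sym2.mem_mk_left _ _, ?_⟩
  swap
  · rw [Equiv.apply_symm_apply]; exact Sym2.mem_mk_right _ _
  have h1 := injective_cycleEdge hk hα h
  refine finRotate_ne_self hk ((finRotate k).symm i) ?_
  rw [Equiv.apply_symm_apply]
  exact h1

lemma two_le_card_filter_mem (hk : 3 ≤ k) {α : Fin k → V} (hα : Function.Injective α)
    {F : Finset (Sym2 V)} (hF : cycleEdges α ⊆ F) (i : Fin k) :
    2 ≤ (F.filter fun e => α i ∈ e).card := by
  obtain ⟨e, he, e', he', hne, h1, h2⟩ := exists_two_cycleEdges hk hα i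
  rw [← Finset.card_pair hne]
  refine Finset.card_le_card fun a ha => ?_
  rw [Finset.mem_insert, Finset.mem_singleton] at ha
  rcases ha with rfl | rfl
  exacts [Finset.mem_filter.2 ⟨hF he, h1⟩, Finset.mem_filter.2 ⟨hF he', h2⟩]

/-- If a cycle uses an edge of another cycle but is not contained in it, then it leaves the other
cycle at some vertex, which therefore has degree at least three in the union. -/
lemma exists_three_le_card_filter_mem (hk : 3 ≤ k) {α : Fin k → V}
    {β : Fin l → V} (hα : Function.Injective α)
    (hmeet : ¬ Disjoint (cycleEdges α) (cycleEdges β)) (hsub : ¬ cycleEdges β ⊆ cycleEdges α)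
    {F : Finset (Sym2 V)} (hF : cycleEdges α ∪ cycleEdges β ⊆ F) :
    ∃ i, 3 ≤ (F.filter fun e => α i ∈ e).card := by
  have h1 : ∃ j, s(β j, β (finRotate l j)) ∈ cycleEdges α ∧
      s(β (finRotate l j), β (finRotate l (finRotate l j))) ∉ cycleEdges α := by
    -- otherwise the cyclic shift would propagate membership to all edges of `β`
    by_contra! hcon
    obtain ⟨e, he, he'⟩ := Finset.not_disjoint_iff.1 hmeet
    obtain ⟨j₀, -, rfl⟩ := Finset.mem_image.1 he'
    have h2 := forall_of_finRotate (p := fun j => s(β j, β (finRotate l j)) ∈ cycleEdges α) he hcon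
    refine hsub fun e he => ?_
    obtain ⟨j, -, rfl⟩ := Finset.mem_image.1 he
    exact h2 j
  obtain ⟨j, hj, hj'⟩ := h1
  obtain ⟨i, hi⟩ := mem_range_of_mem_cycleEdges hj (Sym2.mem_mk_right _ _)
  refine ⟨i, ?_⟩
  obtain ⟨e, he, e', he', hne, h1, h2⟩ := exists_two_cycleEdges hk hα i
  set f := s(β (finRotate l j), β (finRotate l (finRotate l j))) with hf
  have hfi : α i ∈ f := by rw [hi]; simp [hf]
  have hef : e ≠ f := fun h => hj' (h ▸ he)
  have hef' : e' ≠ f := fun h => hj' (h ▸ he')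
  rw [← Finset.card_eq_three.2 ⟨e, e', f, hne, hef, hef', rfl⟩]
  refine Finset.card_le_card fun a ha => ?_
  simp only [Finset.mem_insert, Finset.mem_singleton] at ha
  rcases ha with rfl | rfl | rfl
  · exact Finset.mem_filter.2 ⟨hF (Finset.mem_union_left _ he), h1⟩
  · exact Finset.mem_filter.2 ⟨hF (Finset.mem_union_left _ he'), h2⟩
  · exact Finset.mem_filter.2 ⟨hF (Finset.mem_union_right _ (mem_cycleEdges β _)), hfi⟩

end CycleEdges

/-- The vertex after `β j` in a cycle is one of the two neighbours of the same vertex in any cycle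
which contains all its edges. -/
lemma cycleEdge_determines_next {V : Type*} [DecidableEq V] {k : ℕ} {α β : Fin k → V}
    (hα : Function.Injective α) (h : cycleEdges β ⊆ cycleEdges α) {i j : Fin k} (hij : α i = β j) :
    β (finRotate k j) = α (finRotate k i) ∨ β (finRotate k j) = α ((finRotate k).symm i) := by
  obtain ⟨m, -, hm⟩ := Finset.mem_image.1 (h (mem_cycleEdges β j))
  rcases Sym2.eq_iff.1 hm with ⟨h1, h2⟩ | ⟨h1, h2⟩
  · left
    rw [← h2, hα (h1.trans hij.symm)]
  · right
    rw [← h1, ← hα (h2.trans hij.symm), Equiv.symm_apply_apply]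

/-- A cycle is determined by its edge set: the normalisation in `IsCycleLabel` fixes the starting
vertex and the direction. -/
lemma IsCycleLabel.eq_of_cycleEdges_eq {n : ℕ} {k l : CycleLength} {α : Fin k → Fin n}
    {β : Fin l → Fin n} (hα : IsCycleLabel k α) (hβ : IsCycleLabel l β)
    (h : cycleEdges α = cycleEdges β) :
    (⟨k, α⟩ : Σ k : CycleLength, Fin k → Fin n) = ⟨l, β⟩ := by
  obtain rfl : k = l := by
    refine Subtype.ext ?_
    rw [← card_cycleEdges k.2 hα.1, h, card_cycleEdges l.2 hβ.1]
  obtain ⟨hαi, hαm, hαl⟩ := hα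
  obtain ⟨hβi, hβm, hβl⟩ := hβ
  have hk := k.2
  set a : Fin k := ⟨0, by omega⟩ with ha
  have h01 := finRotate_zero_eq_one hk
  have hl0 : (finRotate (k : ℕ)).symm a = ⟨k - 1, by omega⟩ := by
    rw [Equiv.symm_apply_eq]; exact (finRotate_last_eq_zero hk).symm
  have h0 : α a = β a := by
    refine le_antisymm ?_ ?_
    · obtain ⟨i, hi⟩ := mem_range_of_mem_cycleEdges (h.symm ▸ mem_cycleEdges β a)
        (Sym2.mem_mk_left _ _)
      exact hi ▸ hαm i
    · obtain ⟨i, hi⟩ := mem_range_of_mem_cycleEdges (h ▸ mem_cycleEdges α a)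
        (Sym2.mem_mk_left _ _)
      exact hi ▸ hβm i
  have h1 : α (finRotate k a) = β (finRotate k a) := by
    have h2 := cycleEdge_determines_next hαi h.symm.le h0
    have h3 := cycleEdge_determines_next hβi h.le h0.symm
    rw [hl0, h01] at h2 h3
    rw [h01]
    rcases h2 with h2 | h2
    · exact h2.symm
    rcases h3 with h3 | h3
    · exact h3
    · rw [h2, ← h3] at hβl
      exact absurd hαl hβl.asymm
  have h2 := forall_of_finRotate (p := fun i => α i = β i ∧ α (finRotate k i) = β (finRotate k i))
    ⟨h0, h1⟩ fun i hi => ⟨hi.2, by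
      rcases cycleEdge_determines_next hαi h.symm.le hi.2 with h3 | h3
      · exact h3.symm
      · rw [Equiv.symm_apply_apply, hi.1] at h3
        exact absurd (hβi h3) (finRotate_finRotate_ne_self hk i)⟩
  have h3 : α = β := funext fun i => (h2 i).1
  rw [h3]

/-! ### Overlapping cycles are rare -/

/-- The labels of all possible cycles on `n` vertices whose length lies in `A`. -/
noncomputable def cycleLabels (A : Finset CycleLength) (n : ℕ) :
    Finset (Σ k : CycleLength, Fin k → Fin n) :=
  open Classical in A.sigma fun k => Finset.univ.filter fun α : Fin k → Fin n => IsCycleLabel k α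

lemma mem_cycleLabels {A : Finset CycleLength} {n : ℕ} {j : Σ k : CycleLength, Fin k → Fin n} :
    j ∈ cycleLabels A n ↔ j.1 ∈ A ∧ IsCycleLabel j.1 j.2 := by
  simp [cycleLabels]

/-- If `q` is bounded by a product of vertex weights, then its product over a set of edges is
bounded in terms of the vertex degrees. -/
lemma prod_edges_le {V : Type*} [Fintype V] [DecidableEq V] (x : V → ℝ) (q : Sym2 V → ℝ)
    (hq0 : ∀ e, 0 ≤ q e) (hq : ∀ i j, i ≠ j → q s(i, j) ≤ x i * x j) (F : Finset (Sym2 V))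
    (hF : ∀ e ∈ F, ¬ e.IsDiag) :
    ∏ e ∈ F, q e ≤ ∏ v, x v ^ (F.filter fun e => v ∈ e).card := by
  have h1 : ∀ e ∈ F, q e ≤ ∏ v with v ∈ e, x v := by
    intro e he
    have hd := hF e he
    induction e with | h i j => ?_
    rw [Sym2.mk_isDiag_iff] at hd
    refine (hq i j hd).trans (le_of_eq ?_)
    rw [← Finset.prod_pair hd]
    refine Finset.prod_congr ?_ fun _ _ => rfl
    ext v; simp
  refine (Finset.prod_le_prod (fun e _ => hq0 e) h1).trans (le_of_eq ?_)
  rw [Finset.prod_comm' (t' := Finset.univ) (s' := fun v => F.filter fun e => v ∈ e)]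
  · simp
  · intro e v; simp

lemma prod_pow_le_mul_prod_sq {V : Type*} [Fintype V] [DecidableEq V] {x : V → ℝ} {m : ℝ}
    (hx0 : ∀ v, 0 ≤ x v) (hxm : ∀ v, x v ≤ m) (hm : m ≤ 1) (d : V → ℕ) (U : Finset V)
    (hU : ∀ v ∈ U, 2 ≤ d v) {v₀ : V} (hv₀ : v₀ ∈ U) (hd : 3 ≤ d v₀) :
    ∏ v, x v ^ d v ≤ m * ∏ v ∈ U, x v ^ 2 := by
  have hx1 : ∀ v, x v ≤ 1 := fun v => (hxm v).trans hm
  have h1 : ∏ v, x v ^ d v ≤ ∏ v ∈ U, x v ^ d v := by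
    rw [← Finset.prod_mul_prod_compl U]
    exact mul_le_of_le_one_right (Finset.prod_nonneg fun v _ => pow_nonneg (hx0 v) _)
      (Finset.prod_le_one (fun v _ => pow_nonneg (hx0 v) _)
        fun v _ => pow_le_one₀ (hx0 v) (hx1 v))
  refine h1.trans ?_
  rw [← Finset.mul_prod_erase U _ hv₀, ← Finset.mul_prod_erase U (fun v => x v ^ 2) hv₀,
    ← mul_assoc]
  refine mul_le_mul ?_ (Finset.prod_le_prod (fun v _ => pow_nonneg (hx0 v) _) fun v hv =>
    pow_le_pow_of_le_one (hx0 v) (hx1 v) (hU v (Finset.mem_of_mem_erase hv)))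
    (Finset.prod_nonneg fun v _ => pow_nonneg (hx0 v) _)
    (mul_nonneg ((hx0 v₀).trans (hxm v₀)) (sq_nonneg _))
  calc x v₀ ^ d v₀ ≤ x v₀ ^ 3 := pow_le_pow_of_le_one (hx0 _) (hx1 _) hd
    _ = x v₀ * x v₀ ^ 2 := by ring
    _ ≤ m * x v₀ ^ 2 := mul_le_mul_of_nonneg_right (hxm _) (sq_nonneg _)

/-- The union of two distinct cycles which share an edge has all degrees at least two and some
degree at least three. -/
lemma prod_union_cycleEdges_le {n : ℕ} {x : Fin n → ℝ} {m : ℝ} (hx0 : ∀ v, 0 ≤ x v)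
    (hxm : ∀ v, x v ≤ m) (hm : m ≤ 1) (q : Sym2 (Fin n) → ℝ) (hq0 : ∀ e, 0 ≤ q e)
    (hq : ∀ i j, i ≠ j → q s(i, j) ≤ x i * x j) {a b : Σ k : CycleLength, Fin k → Fin n}
    (ha : IsCycleLabel a.1 a.2) (hb : IsCycleLabel b.1 b.2) (hab : a ≠ b)
    (hmeet : ¬ Disjoint (cycleEdges a.2) (cycleEdges b.2)) :
    ∏ e ∈ cycleEdges a.2 ∪ cycleEdges b.2, q e
      ≤ m * ∏ v ∈ Finset.univ.image a.2 ∪ Finset.univ.image b.2, x v ^ 2 := by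
  refine (prod_edges_le x q hq0 hq _ fun e he => ?_).trans ?_
  · rcases Finset.mem_union.1 he with he | he
    exacts [not_isDiag_of_mem_cycleEdges a.1.2 ha.1 he, not_isDiag_of_mem_cycleEdges b.1.2 hb.1 he]
  have h3 : ∃ v ∈ Finset.univ.image a.2 ∪ Finset.univ.image b.2,
      3 ≤ ((cycleEdges a.2 ∪ cycleEdges b.2).filter fun e => v ∈ e).card := by
    by_cases hsub : cycleEdges b.2 ⊆ cycleEdges a.2
    · have hsub' : ¬ cycleEdges a.2 ⊆ cycleEdges b.2 := fun h =>
        hab (IsCycleLabel.eq_of_cycleEdges_eq ha hb (h.antisymm hsub))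
      obtain ⟨i, hi⟩ := exists_three_le_card_filter_mem b.1.2 hb.1 (fun h => hmeet h.symm) hsub'
        (F := cycleEdges a.2 ∪ cycleEdges b.2) (Finset.union_comm _ _).le
      exact ⟨_, Finset.mem_union_right _ (Finset.mem_image_of_mem _ (Finset.mem_univ i)), hi⟩
    · obtain ⟨i, hi⟩ := exists_three_le_card_filter_mem a.1.2 ha.1 hmeet hsub le_rfl
      exact ⟨_, Finset.mem_union_left _ (Finset.mem_image_of_mem _ (Finset.mem_univ i)), hi⟩
  obtain ⟨v₀, hv₀, hd⟩ := h3
  refine prod_pow_le_mul_prod_sq hx0 hxm hm _ _ (fun v hv => ?_) hv₀ hd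
  rcases Finset.mem_union.1 hv with hv | hv
  · obtain ⟨i, -, rfl⟩ := Finset.mem_image.1 hv
    exact two_le_card_filter_mem a.1.2 ha.1 Finset.subset_union_left i
  · obtain ⟨i, -, rfl⟩ := Finset.mem_image.1 hv
    exact two_le_card_filter_mem b.1.2 hb.1 Finset.subset_union_right i

/-- An upper bound for the number of pairs of cycles with lengths in `A` which together cover a
given vertex set: the set has at most `2 * A.sup` elements, and a cycle of length `k` on it is
determined by a `k`-tuple of its elements. -/
def overlapConst (A : Finset CycleLength) : ℝ :=
  ((∑ k ∈ A, (2 * A.sup fun k => (k : ℕ)) ^ (k : ℕ) : ℕ) : ℝ) ^ 2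

lemma card_pairs_le (A : Finset CycleLength) (n : ℕ) (U : Finset (Fin n))
    (B : Finset ((Σ k : CycleLength, Fin k → Fin n) × Σ k : CycleLength, Fin k → Fin n))
    (hB : ∀ a ∈ B, a.1 ∈ cycleLabels A n ∧ a.2 ∈ cycleLabels A n ∧
      Finset.univ.image a.1.2 ∪ Finset.univ.image a.2.2 = U) :
    (B.card : ℝ) ≤ overlapConst A := by
  rcases B.eq_empty_or_nonempty with rfl | ⟨b, hb⟩
  · simp [overlapConst]; positivity
  have hle : ∀ j ∈ cycleLabels A n,
      (Finset.univ.image j.2).card ≤ A.sup fun k => (k : ℕ) := by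
    intro j hj
    refine (Finset.card_image_le).trans ?_
    rw [Finset.card_univ, Fintype.card_fin]
    exact Finset.le_sup (f := fun k : CycleLength => (k : ℕ)) (mem_cycleLabels.1 hj).1
  have hU : U.card ≤ 2 * A.sup fun k => (k : ℕ) := by
    obtain ⟨h1, h2, rfl⟩ := hB b hb
    refine (Finset.card_union_le _ _).trans ?_
    have := hle _ h1
    have := hle _ h2
    omega
  set T : Finset (Σ k : CycleLength, Fin k → Fin n) :=
    A.sigma fun k => Fintype.piFinset fun _ : Fin k => U with hT
  have hTc : T.card ≤ ∑ k ∈ A, (2 * A.sup fun k => (k : ℕ)) ^ (k : ℕ) := by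
    rw [hT, Finset.card_sigma]
    refine Finset.sum_le_sum fun k _ => ?_
    simp only [Fintype.card_piFinset, Finset.prod_const, Finset.card_univ, Fintype.card_fin]
    exact Nat.pow_le_pow_left hU _
  have hBT : B ⊆ T ×ˢ T := by
    intro a ha
    obtain ⟨h1, h2, h3⟩ := hB a ha
    rw [Finset.mem_product]
    constructor
    · refine Finset.mem_sigma.2 ⟨(mem_cycleLabels.1 h1).1, Fintype.mem_piFinset.2 fun i => ?_⟩
      exact h3 ▸ Finset.mem_union_left _ (Finset.mem_image_of_mem _ (Finset.mem_univ i))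
    · refine Finset.mem_sigma.2 ⟨(mem_cycleLabels.1 h2).1, Fintype.mem_piFinset.2 fun i => ?_⟩
      exact h3 ▸ Finset.mem_union_right _ (Finset.mem_image_of_mem _ (Finset.mem_univ i))
  have h4 : B.card ≤ (∑ k ∈ A, (2 * A.sup fun k => (k : ℕ)) ^ (k : ℕ)) ^ 2 := by
    refine (Finset.card_le_card hBT).trans ?_
    rw [Finset.card_product, ← sq]
    exact Nat.pow_le_pow_left hTc 2
  rw [overlapConst]
  exact_mod_cast h4

/-- The total probability of pairs of distinct cycles sharing an edge is small if all vertex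
weights are small and the sum of their squares is bounded. -/
lemma sum_overlapping_le (A : Finset CycleLength) {n : ℕ} {x : Fin n → ℝ} {m : ℝ}
    (hx0 : ∀ v, 0 ≤ x v) (hxm : ∀ v, x v ≤ m) (hm0 : 0 ≤ m) (hm : m ≤ 1) (q : Sym2 (Fin n) → ℝ)
    (hq0 : ∀ e, 0 ≤ q e) (hq : ∀ i j, i ≠ j → q s(i, j) ≤ x i * x j) :
    ∑ a ∈ (cycleLabels A n).offDiag with ¬ Disjoint (cycleEdges a.1.2) (cycleEdges a.2.2),
        ∏ e ∈ cycleEdges a.1.2 ∪ cycleEdges a.2.2, q e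
      ≤ overlapConst A * m * Real.exp (∑ v, x v ^ 2) := by
  set B := (cycleLabels A n).offDiag.filter fun a =>
    ¬ Disjoint (cycleEdges a.1.2) (cycleEdges a.2.2) with hB
  have hB' : ∀ a ∈ B, a.1 ∈ cycleLabels A n ∧ a.2 ∈ cycleLabels A n ∧ a.1 ≠ a.2 ∧
      ¬ Disjoint (cycleEdges a.1.2) (cycleEdges a.2.2) := by
    intro a ha
    obtain ⟨h1, h2⟩ := Finset.mem_filter.1 ha
    obtain ⟨h3, h4, h5⟩ := Finset.mem_offDiag.1 h1
    exact ⟨h3, h4, h5, h2⟩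
  calc _ ≤ ∑ a ∈ B, m * ∏ v ∈ Finset.univ.image a.1.2 ∪ Finset.univ.image a.2.2, x v ^ 2 := by
        refine Finset.sum_le_sum fun a ha => ?_
        obtain ⟨h1, h2, h3, h4⟩ := hB' a ha
        exact prod_union_cycleEdges_le hx0 hxm hm q hq0 hq (mem_cycleLabels.1 h1).2
          (mem_cycleLabels.1 h2).2 h3 h4
    _ = ∑ U : Finset (Fin n), ∑ a ∈ B with
          Finset.univ.image a.1.2 ∪ Finset.univ.image a.2.2 = U,
          m * ∏ v ∈ Finset.univ.image a.1.2 ∪ Finset.univ.image a.2.2, x v ^ 2 :=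
        (Finset.sum_fiberwise B _ _).symm
    _ ≤ ∑ U : Finset (Fin n), overlapConst A * m * ∏ v ∈ U, x v ^ 2 := by
        refine Finset.sum_le_sum fun U _ => ?_
        have h1 : ∑ a ∈ B with Finset.univ.image a.1.2 ∪ Finset.univ.image a.2.2 = U,
            m * ∏ v ∈ Finset.univ.image a.1.2 ∪ Finset.univ.image a.2.2, x v ^ 2
            = ∑ a ∈ B with Finset.univ.image a.1.2 ∪ Finset.univ.image a.2.2 = U,
              m * ∏ v ∈ U, x v ^ 2 :=
          Finset.sum_congr rfl fun a ha => by rw [(Finset.mem_filter.1 ha).2]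
        rw [h1, Finset.sum_const, nsmul_eq_mul, mul_assoc]
        refine mul_le_mul_of_nonneg_right ?_
          (mul_nonneg hm0 (Finset.prod_nonneg fun v _ => sq_nonneg _))
        refine card_pairs_le A n U _ fun a ha => ?_
        obtain ⟨h2, h3⟩ := Finset.mem_filter.1 ha
        exact ⟨(hB' a h2).1, (hB' a h2).2.1, h3⟩
    _ = overlapConst A * m * ∏ v, (1 + x v ^ 2) := by
        rw [← Finset.mul_sum, Finset.prod_one_add, Finset.powerset_univ]
    _ ≤ _ := by
        refine mul_le_mul_of_nonneg_left ?_ (mul_nonneg (sq_nonneg _) hm0)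
        rw [Real.exp_sum]
        refine Finset.prod_le_prod (fun v _ => by positivity) fun v _ => ?_
        rw [add_comm]
        exact Real.add_one_le_exp _

/-! ### Summing over cycles -/

section Symmetrisation

variable {n : ℕ} (k : CycleLength)

instance : NeZero (k : ℕ) := ⟨by have := k.2; omega⟩

lemma isCycleLabel_iff (α : Fin k → Fin n) :
    IsCycleLabel k α ↔ Function.Injective α ∧ (∀ i, α 0 ≤ α i) ∧ α 1 < α (-1) := by
  have h0 : (⟨0, by have := k.2; omega⟩ : Fin k) = 0 := rfl
  have h1 : (⟨1, by have := k.2; omega⟩ : Fin k) = 1 := by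
    rw [← finRotate_zero_eq_one k.2, h0, finRotate_apply, zero_add]
  have h2 : (⟨k - 1, by have := k.2; omega⟩ : Fin k) = -1 := by
    have := finRotate_last_eq_zero k.2
    rw [finRotate_apply, h0] at this
    exact eq_neg_of_add_eq_zero_left this
  unfold IsCycleLabel
  rw [h0, h1, h2]

lemma Fin.one_ne_neg_one_of_cycleLength : (1 : Fin k) ≠ -1 := by
  intro h
  have h1 := finRotate_finRotate_ne_self k.2 (-1)
  rw [finRotate_apply, finRotate_apply, neg_add_cancel, zero_add] at h1
  exact h1 h

open Classical in
/-- Every injective tuple is turned into a cycle label by exactly one rotation or reflection. -/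
lemma sum_isCycleLabel_eq_one {α : Fin k → Fin n} (hα : Function.Injective α) :
    ∑ r : Fin k, ((if IsCycleLabel k (α ∘ Equiv.addLeft r) then (1 : ℝ) else 0)
      + if IsCycleLabel k (α ∘ Equiv.subLeft r) then (1 : ℝ) else 0) = 1 := by
  -- the starting point has to be the position of the minimum; the order of its two neighbours
  -- then decides between the rotation and the reflection
  obtain ⟨r₀, hr₀⟩ := Finite.exists_min α
  have hadd : ∀ r, IsCycleLabel k (α ∘ Equiv.addLeft r) ↔ r = r₀ ∧ α (r + 1) < α (r - 1) := by
    intro r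
    rw [isCycleLabel_iff]
    simp only [Function.comp_apply, Equiv.coe_addLeft, add_zero, ← sub_eq_add_neg]
    constructor
    · rintro ⟨-, h2, h3⟩
      refine ⟨hα (le_antisymm ?_ (hr₀ r)), h3⟩
      have := h2 (r₀ - r)
      rwa [add_sub_cancel] at this
    · rintro ⟨rfl, h3⟩
      exact ⟨hα.comp (Equiv.addLeft r).injective, fun i => hr₀ _, h3⟩
  have hsub : ∀ r, IsCycleLabel k (α ∘ Equiv.subLeft r) ↔ r = r₀ ∧ α (r - 1) < α (r + 1) := by
    intro r
    rw [isCycleLabel_iff]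
    simp only [Function.comp_apply, Equiv.subLeft_apply, sub_zero, sub_neg_eq_add]
    constructor
    · rintro ⟨-, h2, h3⟩
      refine ⟨hα (le_antisymm ?_ (hr₀ r)), h3⟩
      have := h2 (r - r₀)
      rwa [sub_sub_cancel] at this
    · rintro ⟨rfl, h3⟩
      exact ⟨hα.comp (Equiv.subLeft r).injective, fun i => hr₀ _, h3⟩
  simp_rw [hadd, hsub]
  rw [Finset.sum_eq_single r₀]
  · have hne : α (r₀ + 1) ≠ α (r₀ - 1) := fun h => by
      have := hα h
      rw [sub_eq_add_neg] at this
      exact Fin.one_ne_neg_one_of_cycleLength k (add_left_cancel this)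
    rcases lt_or_gt_of_ne hne with h | h
    · simp [h, h.not_gt]
    · simp [h, h.not_gt]
  · intro r _ hr
    simp [hr]
  · simp

open Classical in
/-- Each cycle of length `k` corresponds to `2 k` injective tuples. -/
lemma sum_injective_eq_two_mul_sum_isCycleLabel (q : Sym2 (Fin n) → ℝ) :
    ∑ α : Fin k → Fin n with Function.Injective α, ∏ i, q s(α i, α (finRotate k i))
      = 2 * (k : ℝ) * ∑ α : Fin k → Fin n with IsCycleLabel k α,
          ∏ i, q s(α i, α (finRotate k i)) := by
  set f : (Fin k → Fin n) → ℝ := fun α => ∏ i, q s(α i, α (finRotate k i)) with hf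
  have hadd : ∀ r α, f (α ∘ Equiv.addLeft r) = f α := by
    intro r α
    simp only [hf]
    refine Fintype.prod_equiv (Equiv.addLeft r) _ _ fun i => ?_
    simp only [Function.comp_apply, Equiv.coe_addLeft, finRotate_apply, add_assoc]
  have hsub : ∀ r α, f (α ∘ Equiv.subLeft r) = f α := by
    intro r α
    simp only [hf]
    rw [← ((Equiv.addRight 1).trans (Equiv.subLeft r)).prod_comp fun i =>
      q s(α i, α (finRotate k i))]
    refine Finset.prod_congr rfl fun i _ => ?_
    simp only [Function.comp_apply, Equiv.subLeft_apply, Equiv.trans_apply, Equiv.coe_addRight,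
      finRotate_apply]
    rw [Sym2.eq_swap]
    congr 4
    abel
  have hsum : ∀ g : Fin k ≃ Fin k, (∀ α, f (α ∘ g) = f α) →
      ∑ α, (if IsCycleLabel k (α ∘ g) then f α else 0)
        = ∑ α : Fin k → Fin n with IsCycleLabel k α, f α := by
    intro g hg
    rw [Finset.sum_filter]
    refine Fintype.sum_equiv (Equiv.arrowCongr g.symm (Equiv.refl (Fin n))) _ _ fun α => ?_
    have : (Equiv.arrowCongr g.symm (Equiv.refl (Fin n))) α = α ∘ g := by ext; simp
    rw [this, hg]
  have h1 : ∀ α : Fin k → Fin n, (if Function.Injective α then f α else 0)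
      = ∑ r : Fin k, ((if IsCycleLabel k (α ∘ Equiv.addLeft r) then f α else 0)
        + if IsCycleLabel k (α ∘ Equiv.subLeft r) then f α else 0) := by
    intro α
    by_cases hα : Function.Injective α
    · rw [if_pos hα]
      refine (one_mul (f α)).symm.trans ?_
      rw [← sum_isCycleLabel_eq_one k hα, Finset.sum_mul]
      refine Finset.sum_congr rfl fun r _ => ?_
      simp only [add_mul, ite_mul, one_mul, zero_mul]
    · rw [if_neg hα]
      refine (Finset.sum_eq_zero fun r _ => ?_).symm
      rw [if_neg, if_neg, add_zero]
      · exact fun h => hα ((Equiv.injective_comp _ _).1 h.1)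
      · exact fun h => hα ((Equiv.injective_comp _ _).1 h.1)
  rw [Finset.sum_filter, Finset.sum_congr rfl fun α _ => h1 α, Finset.sum_comm]
  simp_rw [Finset.sum_add_distrib]
  rw [Finset.sum_congr rfl fun r _ => hsum (Equiv.addLeft r) (hadd r),
    Finset.sum_congr rfl fun r _ => hsum (Equiv.subLeft r) (hsub r)]
  simp only [Finset.sum_const, Finset.card_univ, Fintype.card_fin, nsmul_eq_mul]
  ring

end Symmetrisation

section InjectiveSums

variable {V : Type*} [Fintype V] [DecidableEq V]

open Classical in
/-- Extending an injective tuple by one further entry. -/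
lemma sum_injective_succ (y : V → ℝ) (k : ℕ) :
    ∑ α : Fin (k + 1) → V with Function.Injective α, ∏ i, y (α i)
      = ∑ α : Fin k → V with Function.Injective α,
          (∏ i, y (α i)) * (∑ v, y v - ∑ i, y (α i)) := by
  rw [Finset.sum_filter, ← (Fin.consEquiv fun _ => V).sum_comp, Fintype.sum_prod_type,
    Finset.sum_comm, Finset.sum_filter]
  refine Finset.sum_congr rfl fun α _ => ?_
  have h1 : ∀ v : V, (Fin.consEquiv fun _ => V) (v, α) = Fin.cons v α := fun v => rfl
  simp_rw [h1, Fin.prod_univ_succ, Fin.cons_zero, Fin.cons_succ, Fin.cons_injective_iff]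
  by_cases hα : Function.Injective α
  · simp only [hα, and_true, if_true]
    rw [← Finset.sum_image (f := y) (g := α) (s := Finset.univ) (fun a _ b _ h => hα h),
      ← Finset.sum_compl_add_sum (Finset.univ.image α) y, add_sub_cancel_right, Finset.mul_sum,
      ← Finset.sum_filter]
    refine Finset.sum_congr ?_ fun v _ => mul_comm _ _
    ext v; simp
  · simp [hα]

open Classical in
/-- If all summands become small, then restricting a `k`-fold sum to injective tuples does not
change its limit. -/
lemma tendsto_sum_injective {y : ∀ n, Fin n → ℝ} {ρ : ℝ} {M : ℕ → ℝ} (hy0 : ∀ n v, 0 ≤ y n v)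
    (hyM : ∀ n v, y n v ≤ M n) (hM : Tendsto M atTop (𝓝 0))
    (hρ : Tendsto (fun n => ∑ v, y n v) atTop (𝓝 ρ)) (k : ℕ) :
    Tendsto (fun n => ∑ α : Fin k → Fin n with Function.Injective α, ∏ i, y n (α i)) atTop
      (𝓝 (ρ ^ k)) := by
  induction k with
  | zero => simp [Function.injective_of_subsingleton]
  | succ k ih =>
    have hlow := ih.mul (hρ.sub (hM.const_mul (k : ℝ)))
    have hup := ih.mul hρ
    rw [mul_zero, sub_zero, ← pow_succ] at hlow
    rw [← pow_succ] at hup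
    refine tendsto_of_tendsto_of_tendsto_of_le_of_le hlow hup (fun n => ?_) fun n => ?_
    · rw [sum_injective_succ]
      simp only [Finset.sum_mul]
      refine Finset.sum_le_sum fun α _ =>
        mul_le_mul_of_nonneg_left ?_ (Finset.prod_nonneg fun i _ => hy0 n _)
      have : ∑ i, y n (α i) ≤ ∑ _i : Fin k, M n := Finset.sum_le_sum fun i _ => hyM n _
      simp only [Finset.sum_const, Finset.card_univ, Fintype.card_fin, nsmul_eq_mul] at this
      linarith
    · rw [sum_injective_succ]
      simp only [Finset.sum_mul]
      refine Finset.sum_le_sum fun α _ =>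
        mul_le_mul_of_nonneg_left ?_ (Finset.prod_nonneg fun i _ => hy0 n _)
      have : 0 ≤ ∑ i, y n (α i) := Finset.sum_nonneg fun i _ => hy0 n _
      linarith

end InjectiveSums

open Classical in
/-- The expected number of cycles of length `k`, conditionally on the weights, converges. -/
lemma tendsto_sum_prod_cycleEdges {x : ∀ n, Fin n → ℝ} {ρ : ℝ} {m : ℕ → ℝ}
    (hx0 : ∀ n v, 0 ≤ x n v) (hxm : ∀ n v, x n v ≤ m n) (hm : Tendsto m atTop (𝓝 0))
    (hρ : Tendsto (fun n => ∑ v, x n v ^ 2) atTop (𝓝 ρ)) (p : ∀ n, Sym2 (Fin n) → I)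
    (hp : ∀ n i j, i ≠ j → (p n s(i, j) : ℝ) ≤ x n i * x n j)
    (hp' : ∀ n i j, i ≠ j → x n i * x n j ≤ (1 + m n ^ 2) * p n s(i, j)) (k : CycleLength) :
    Tendsto (fun n => ∑ α : Fin k → Fin n with IsCycleLabel k α,
      ∏ e ∈ cycleEdges α, (p n e : ℝ)) atTop (𝓝 (1 / (2 * (k : ℝ)) * ρ ^ (k : ℕ))) := by
  have hm2 : Tendsto (fun n => m n ^ 2) atTop (𝓝 0) := by simpa using hm.pow 2
  have hinj : Tendsto (fun n => ∑ α : Fin k → Fin n with Function.Injective α,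
      ∏ i, x n (α i) ^ 2) atTop (𝓝 (ρ ^ (k : ℕ))) :=
    tendsto_sum_injective (fun n v => sq_nonneg (x n v))
      (fun n v => pow_le_pow_left₀ (hx0 n v) (hxm n v) 2) hm2 hρ k
  have hlim : Tendsto (fun n => ∑ α : Fin k → Fin n with Function.Injective α,
      ∏ i, (p n s(α i, α (finRotate k i)) : ℝ)) atTop (𝓝 (ρ ^ (k : ℕ))) := by
    have hlow : Tendsto (fun n => ((1 + m n ^ 2) ^ (k : ℕ))⁻¹ *
        ∑ α : Fin k → Fin n with Function.Injective α, ∏ i, x n (α i) ^ 2) atTop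
        (𝓝 (ρ ^ (k : ℕ))) := by
      have := (((hm2.const_add 1).pow (k : ℕ)).inv₀ (by simp)).mul hinj
      simpa using this
    have hsq : ∀ n (α : Fin k → Fin n),
        ∏ i, x n (α i) ^ 2 = ∏ i, (x n (α i) * x n (α (finRotate k i))) := by
      intro n α
      rw [Finset.prod_mul_distrib, Equiv.prod_comp (finRotate k) fun i => x n (α i),
        ← Finset.prod_mul_distrib]
      simp only [sq]
    have hne : ∀ n (α : Fin k → Fin n), Function.Injective α → ∀ i, α i ≠ α (finRotate k i) :=
      fun n α hα i h => finRotate_ne_self k.2 i (hα h).symm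
    refine tendsto_of_tendsto_of_tendsto_of_le_of_le hlow hinj (fun n => ?_) fun n => ?_
    · change _ * _ ≤ _
      rw [inv_mul_le_iff₀ (by positivity), Finset.mul_sum]
      refine Finset.sum_le_sum fun α hα => ?_
      have hα' := (Finset.mem_filter.1 hα).2
      rw [hsq]
      refine (Finset.prod_le_prod (fun i _ => mul_nonneg (hx0 n _) (hx0 n _))
        fun i _ => hp' n _ _ (hne n α hα' i)).trans (le_of_eq ?_)
      rw [Finset.prod_mul_distrib]
      simp
    · refine Finset.sum_le_sum fun α hα => ?_
      have hα' := (Finset.mem_filter.1 hα).2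
      rw [hsq]
      exact Finset.prod_le_prod (fun i _ => (p n _).2.1) fun i _ => hp n _ _ (hne n α hα' i)
  have hk : (0 : ℝ) < 2 * (k : ℝ) := by
    have h3 := k.2
    have : (0 : ℝ) < (k : ℝ) := by exact_mod_cast (by omega : 0 < (k : ℕ))
    linarith
  refine (hlim.const_mul (1 / (2 * (k : ℝ)))).congr fun n => ?_
  rw [sum_injective_eq_two_mul_sum_isCycleLabel k fun e => (p n e : ℝ), ← mul_assoc,
    one_div_mul_cancel hk.ne', one_mul]
  refine Finset.sum_congr rfl fun α hα => ?_
  have hα' := (Finset.mem_filter.1 hα).2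
  rw [cycleEdges, Finset.prod_image fun i _ j _ h => injective_cycleEdge k.2 hα'.1 h]

/-- The Poisson limit for deterministic weights, in terms of generating functions. -/
lemma tendsto_integral_prod_cycleLabels {x : ∀ n, Fin n → ℝ} {ρ : ℝ} {m : ℕ → ℝ}
    (hx0 : ∀ n v, 0 ≤ x n v) (hxm : ∀ n v, x n v ≤ m n) (hm0 : ∀ n, 0 ≤ m n)
    (hm : Tendsto m atTop (𝓝 0))
    (hρ : Tendsto (fun n => ∑ v, x n v ^ 2) atTop (𝓝 ρ)) (p : ∀ n, Sym2 (Fin n) → I)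
    (hp : ∀ n i j, i ≠ j → (p n s(i, j) : ℝ) ≤ x n i * x n j)
    (hp' : ∀ n i j, i ≠ j → x n i * x n j ≤ (1 + m n ^ 2) * p n s(i, j))
    (A : Finset CycleLength) (t : CycleLength → ℂ) (ht : ∀ k, ‖1 - t k‖ ≤ 1) :
    Tendsto (fun n => ∫ c, ∏ j ∈ cycleLabels A n, (1 - t j.1 * allOpen (cycleEdges j.2) c)
        ∂configMeasure (p n)) atTop
      (𝓝 (Complex.exp (-∑ k ∈ A, t k * ((1 / (2 * (k : ℝ)) * ρ ^ (k : ℕ) : ℝ) : ℂ)))) := by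
  classical
  set q : ∀ n, (Σ k : CycleLength, Fin k → Fin n) → ℝ :=
    fun n j => ∏ e ∈ cycleEdges j.2, (p n e : ℝ) with hq
  have hΛ := tendsto_sum_prod_cycleEdges hx0 hxm hm hρ p hp hp'
  have hq0 : ∀ n j, 0 ≤ q n j := fun n j => Finset.prod_nonneg fun e _ => (p n e).2.1
  have hqm : ∀ n, ∀ j ∈ cycleLabels A n, q n j ≤ m n ^ 2 := by
    intro n j hj
    have hj' := (mem_cycleLabels.1 hj).2
    have h3 := j.1.2
    have hmem := mem_cycleEdges j.2 ⟨0, by omega⟩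
    rw [hq]
    simp only
    rw [← Finset.mul_prod_erase _ _ hmem]
    refine (mul_le_of_le_one_right (p n _).2.1 (Finset.prod_le_one (fun e _ => (p n e).2.1)
      fun e _ => (p n e).2.2)).trans ?_
    refine (hp n _ _ fun h => finRotate_ne_self h3 _ (hj'.1 h).symm).trans ?_
    rw [sq]
    exact mul_le_mul (hxm n _) (hxm n _) (hx0 n _) (hm0 n)
  have hsum : ∀ {R : Type} [AddCommMonoid R] n (f : (Σ k : CycleLength, Fin k → Fin n) → R),
      ∑ j ∈ cycleLabels A n, f j
        = ∑ k ∈ A, ∑ α : Fin k → Fin n with IsCycleLabel k α, f ⟨k, α⟩ := by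
    intro R _ n f
    rw [cycleLabels, Finset.sum_sigma]
  have hm2 : Tendsto (fun n => m n ^ 2) atTop (𝓝 0) := by simpa using hm.pow 2
  -- the error made by decoupling the indicators
  have herr1 : Tendsto (fun n =>
      8 * (overlapConst A * m n * Real.exp (∑ v, x n v ^ 2))) atTop (𝓝 0) := by
    have := (((hm.const_mul (overlapConst A)).mul
      (Real.continuous_exp.continuousAt.tendsto.comp hρ)).const_mul 8)
    simpa using this
  -- the error made by passing from Bernoulli to Poisson factors
  have herr2 : Tendsto (fun n => 4 * m n ^ 2 * ∑ j ∈ cycleLabels A n, q n j) atTop (𝓝 0) := by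
    simp_rw [hsum]
    have := (hm2.const_mul 4).mul (tendsto_finsetSum A fun k _ => hΛ k)
    simpa using this
  have hexp : Tendsto (fun n => Complex.exp (-∑ j ∈ cycleLabels A n, t j.1 * (q n j : ℂ))) atTop
      (𝓝 (Complex.exp (-∑ k ∈ A, t k * ((1 / (2 * (k : ℝ)) * ρ ^ (k : ℕ) : ℝ) : ℂ)))) := by
    refine (Complex.continuous_exp.continuousAt.tendsto).comp (Tendsto.neg ?_)
    simp_rw [hsum, ← Finset.mul_sum]
    refine tendsto_finsetSum A fun k _ => Tendsto.const_mul _ ?_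
    have := (Complex.continuous_ofReal.continuousAt.tendsto).comp (hΛ k)
    refine this.congr fun n => ?_
    simp only [Function.comp_apply, hq]
    push_cast
    rfl
  refine tendsto_of_tendsto_of_dist hexp ?_
  refine squeeze_zero' (Eventually.of_forall fun n => dist_nonneg) ?_
    (by simpa using herr1.add herr2)
  filter_upwards [hm.eventually_le_const zero_lt_one, hm2.eventually_le_const one_half_pos]
    with n h1 h2
  rw [dist_comm, dist_eq_norm]
  have b1 := norm_integral_prod_one_sub_sub_le (p n)
    (fun j : Σ k : CycleLength, Fin k → Fin n => cycleEdges j.2) (fun j => t j.1)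
    (fun j => ht j.1) (cycleLabels A n)
  have b2 := sum_overlapping_le A (hx0 n) (hxm n) (hm0 n) h1 (fun e => (p n e : ℝ))
    (fun e => (p n e).2.1) (hp n)
  have b3 := norm_prod_one_sub_sub_exp_le (fun j : Σ k : CycleLength, Fin k → Fin n => t j.1)
    (fun j => ht j.1) (fun j => q n j) h2 (hq0 n) (s := cycleLabels A n)
  have b3' := b3 (hqm n)
  refine (norm_sub_le_norm_sub_add_norm_sub _
    (∏ j ∈ cycleLabels A n, (1 - t j.1 * (q n j : ℂ))) _).trans ?_
  refine add_le_add (b1.trans ?_) b3'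
  exact mul_le_mul_of_nonneg_left b2 (by norm_num)

/-! ### From i.i.d. weights to deterministic weights -/

/-- If the averages of a nonnegative sequence converge, then its running maximum is sublinear. -/
lemma tendsto_iSup_div_of_tendsto_average {a : ℕ → ℝ} {s : ℝ} (ha : ∀ i, 0 ≤ a i)
    (h : Tendsto (fun n : ℕ => (∑ i ∈ Finset.range n, a i) / n) atTop (𝓝 s)) :
    Tendsto (fun n : ℕ => (⨆ v : Fin n, a v) / n) atTop (𝓝 0) := by
  -- a single term is a difference of consecutive partial sums
  have h1 : Tendsto (fun n : ℕ => a n / n) atTop (𝓝 0) := by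
    have h2 := (tendsto_add_atTop_iff_nat (f := fun n : ℕ =>
      (∑ i ∈ Finset.range n, a i) / (n : ℝ)) 1).2 h
    have h3 : Tendsto (fun n : ℕ => 1 + 1 / (n : ℝ)) atTop (𝓝 (1 + 0)) :=
      tendsto_const_nhds.add tendsto_one_div_atTop_nhds_zero_nat
    have h4 := (h2.mul h3).sub h
    simp only [add_zero, mul_one, sub_self] at h4
    refine h4.congr' ?_
    filter_upwards [eventually_gt_atTop 0] with n hn
    have hn' : (0 : ℝ) < n := by exact_mod_cast hn
    rw [Finset.sum_range_succ]
    push_cast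
    field_simp
    ring
  refine (Metric.tendsto_atTop).2 fun ε hε => ?_
  obtain ⟨N, hN⟩ := (Metric.tendsto_atTop).1 h1 (ε / 2) (half_pos hε)
  obtain ⟨N', hN'⟩ := exists_nat_gt ((∑ i ∈ Finset.range (N + 1), a i) / (ε / 2))
  refine ⟨max N' 1, fun n hn => ?_⟩
  have hn1 : 1 ≤ n := (le_max_right _ _).trans hn
  have hn0 : (0 : ℝ) < n := by exact_mod_cast hn1
  have hb : (⨆ v : Fin n, a v) ≤ ε / 2 * n := by
    refine Real.iSup_le (fun v => ?_) (by positivity)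
    rcases lt_or_ge (v : ℕ) (N + 1) with hv | hv
    · have h2 : a v ≤ ∑ i ∈ Finset.range (N + 1), a i :=
        Finset.single_le_sum (fun i _ => ha i) (Finset.mem_range.2 hv)
      rw [div_lt_iff₀ (half_pos hε)] at hN'
      have h3 : (N' : ℝ) ≤ n := by exact_mod_cast (le_max_left _ _).trans hn
      nlinarith
    · have h2 := hN v (by omega)
      have hv0 : (0 : ℝ) < (v : ℕ) := by exact_mod_cast (by omega : 0 < (v : ℕ))
      rw [Real.dist_0_eq_abs, abs_of_nonneg (div_nonneg (ha _) hv0.le), div_lt_iff₀ hv0] at h2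
      have h3 : ((v : ℕ) : ℝ) ≤ n := by exact_mod_cast v.2.le
      nlinarith
  have h0 : 0 ≤ ⨆ v : Fin n, a v := Real.iSup_nonneg fun v => ha v
  rw [Real.dist_0_eq_abs, abs_of_nonneg (by positivity), div_lt_iff₀ hn0]
  nlinarith

/-- Along a sequence of weights obeying the law of large numbers, the cycle generating function
converges. The weights are normalised to `X v / √L`, so that the connection probabilities are
nearly products. -/
lemma tendsto_integral_prod_cycleLabels_of_averages {X : ℕ → ℝ} {s₁ s₂ : ℝ} (hX : ∀ i, 0 < X i)
    (hs₁ : 0 < s₁)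
    (h1 : Tendsto (fun n : ℕ => (∑ i ∈ Finset.range n, X i) / n) atTop (𝓝 s₁))
    (h2 : Tendsto (fun n : ℕ => (∑ i ∈ Finset.range n, X i ^ 2) / n) atTop (𝓝 s₂))
    (A : Finset CycleLength) (t : CycleLength → ℂ) (ht : ∀ k, ‖1 - t k‖ ≤ 1) :
    Tendsto (fun n => ∫ c, ∏ j ∈ cycleLabels A n, (1 - t j.1 * allOpen (cycleEdges j.2) c)
        ∂configMeasure (edgeProb fun v : Fin n => X v)) atTop
      (𝓝 (Complex.exp
        (-∑ k ∈ A, t k * ((1 / (2 * (k : ℝ)) * (s₂ / s₁) ^ (k : ℕ) : ℝ) : ℂ)))) := by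
  set L : ℕ → ℝ := fun n => ∑ v : Fin n, X v with hL
  have hLr : ∀ n, L n = ∑ i ∈ Finset.range n, X i := fun n => Fin.sum_univ_eq_sum_range X n
  have hL0 : ∀ n, 0 ≤ L n := fun n => Finset.sum_nonneg fun v _ => (hX v).le
  have hLpos : ∀ n, Fin n → 0 < L n := fun n v =>
    Finset.sum_pos (fun v _ => hX v) ⟨v, Finset.mem_univ v⟩
  have hb : Tendsto (fun n => (⨆ v : Fin n, X v ^ 2) / L n) atTop (𝓝 0) := by
    have h3 := (tendsto_iSup_div_of_tendsto_average (fun i => sq_nonneg (X i)) h2).div h1 hs₁.ne'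
    rw [zero_div] at h3
    refine h3.congr' ?_
    filter_upwards [eventually_gt_atTop 0] with n hn
    have hn' : (n : ℝ) ≠ 0 := by exact_mod_cast hn.ne'
    rw [hLr]
    exact div_div_div_cancel_right₀ hn' _ _
  have hprod : ∀ n (i j : Fin n), X i / √(L n) * (X j / √(L n)) = X i * X j / L n := by
    intro n i j
    rw [div_mul_div_comm, Real.mul_self_sqrt (hL0 n)]
  have hle : ∀ n (v : Fin n), X v / √(L n) ≤ √((⨆ v : Fin n, X v ^ 2) / L n) := by
    intro n v
    refine Real.le_sqrt_of_sq_le ?_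
    rw [div_pow, Real.sq_sqrt (hL0 n)]
    exact div_le_div_of_nonneg_right
      (le_ciSup (f := fun v : Fin n => X v ^ 2) (Set.finite_range _).bddAbove v) (hL0 n)
  have hnn : ∀ n (v : Fin n), 0 ≤ X v / √(L n) := fun n v =>
    div_nonneg (hX v).le (Real.sqrt_nonneg _)
  refine tendsto_integral_prod_cycleLabels (x := fun n v => X v / √(L n))
    (m := fun n => √((⨆ v : Fin n, X v ^ 2) / L n)) hnn hle (fun n => Real.sqrt_nonneg _)
    (by simpa using hb.sqrt) ?_ (fun n => edgeProb fun v : Fin n => X v) ?_ ?_ A t ht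
  · refine (h2.div h1 hs₁.ne').congr' ?_
    filter_upwards [eventually_gt_atTop 0] with n hn
    have hn' : (n : ℝ) ≠ 0 := by exact_mod_cast hn.ne'
    refine (div_div_div_cancel_right₀ hn' _ _).trans ?_
    rw [← hLr, ← Fin.sum_univ_eq_sum_range (fun i => X i ^ 2),
      Finset.sum_div]
    refine Finset.sum_congr rfl fun v _ => ?_
    rw [div_pow, Real.sq_sqrt (hL0 n)]
  · intro n i j hij
    rw [coe_edgeProb (fun v : Fin n => hX v) hij, hprod, connectionProb]
    have hw : 0 < X i * X j := mul_pos (hX i) (hX j)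
    refine div_le_div_of_nonneg_left hw.le (hLpos n i) ?_
    change L n ≤ X i * X j + L n
    linarith
  · intro n i j hij
    have hw : 0 < X i * X j := mul_pos (hX i) (hX j)
    have hp := hLpos n i
    have hm : X i * X j / L n ≤ √((⨆ v : Fin n, X v ^ 2) / L n) ^ 2 := by
      rw [← hprod, sq]
      exact mul_le_mul (hle n i) (hle n j) (hnn n j) (Real.sqrt_nonneg _)
    have hc : (0 : ℝ) ≤ edgeProb (fun v : Fin n => X v) s(i, j) := (edgeProb _ _).2.1
    rw [hprod]
    calc X i * X j / L n
        = (1 + X i * X j / L n) * edgeProb (fun v : Fin n => X v) s(i, j) := by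
          rw [coe_edgeProb (fun v : Fin n => hX v) hij, connectionProb]
          change _ = _ * (X i * X j / (X i * X j + L n))
          have : X i * X j + L n ≠ 0 := by positivity
          field_simp
          ring
      _ ≤ _ := mul_le_mul_of_nonneg_right (by linarith) hc

section Weights

variable {Ω₀ Ω : Type*} [MeasurableSpace Ω₀] [MeasurableSpace Ω] {W₀ : Ω₀ → ℝ} {P₀ : Measure Ω₀}

lemma IsGeneralisedRandomGraph.map_weight_eq {n : ℕ} {w : Fin n → Ω → ℝ}
    {G : Ω → SimpleGraph (Fin n)} {P : Measure Ω} [IsProbabilityMeasure P]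
    (hG : IsGeneralisedRandomGraph W₀ P₀ w G P) :
    P.map (fun ω l => w l ω) = Measure.pi fun _ => P₀.map W₀ := by
  rw [(iIndepFun_iff_map_fun_eq_pi_map fun i => (hG.measurable_weight i).aemeasurable).1
    hG.indep_weight]
  simp_rw [fun i => (hG.identDistrib i).map_eq]

lemma map_infinitePi_fin (μ : Measure ℝ) [IsProbabilityMeasure μ] (n : ℕ) :
    (Measure.infinitePi fun _ : ℕ => μ).map (fun X (v : Fin n) => X v)
      = Measure.pi fun _ => μ := by
  have h := (iIndepFun_infinitePi (P := fun _ : ℕ => μ) (X := fun _ x => x)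
    fun _ => measurable_id).precomp (g := fun v : Fin n => (v : ℕ)) Fin.val_injective
  rw [(iIndepFun_iff_map_fun_eq_pi_map
    fun i : Fin n => (measurable_pi_apply (i : ℕ)).aemeasurable).1 h]
  congr 1
  ext1 i
  exact Measure.infinitePi_map_eval (fun _ : ℕ => μ) i

/-- The strong law of large numbers for a measurable function of the coordinates. -/
lemma ae_tendsto_average_infinitePi (μ : Measure ℝ) [IsProbabilityMeasure μ] {f : ℝ → ℝ}
    (hf : Measurable f) (hint : Integrable f μ) :
    ∀ᵐ X ∂Measure.infinitePi fun _ : ℕ => μ,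
      Tendsto (fun n : ℕ => (∑ i ∈ Finset.range n, f (X i)) / n) atTop (𝓝 (∫ x, f x ∂μ)) := by
  have hmp : ∀ i : ℕ, (Measure.infinitePi fun _ : ℕ => μ).map (fun X => X i) = μ :=
    Measure.infinitePi_map_eval (fun _ : ℕ => μ)
  have hid : ∀ i : ℕ, IdentDistrib (fun X : ℕ → ℝ => f (X i)) f
      (Measure.infinitePi fun _ : ℕ => μ) μ := by
    intro i
    refine ⟨(hf.comp (measurable_pi_apply i)).aemeasurable, hf.aemeasurable, ?_⟩
    have := Measure.map_map (μ := Measure.infinitePi fun _ : ℕ => μ) hf (measurable_pi_apply i)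
    rw [hmp i] at this
    exact this.symm
  have hind := iIndepFun_infinitePi (P := fun _ : ℕ => μ) (X := fun _ x => f x) fun _ => hf
  have := strong_law_ae_real (μ := Measure.infinitePi fun _ : ℕ => μ) (fun i X => f (X i))
    ((hid 0).integrable_iff.2 hint) (fun i j hij => hind.indepFun hij)
    fun i => (hid i).trans (hid 0).symm
  rwa [(hid 0).integral_eq] at this

variable {Ω : ℕ → Type*} [∀ n, MeasurableSpace (Ω n)] {P : ∀ n, Measure (Ω n)}
  [∀ n, IsProbabilityMeasure (P n)] {w : ∀ n, Fin n → Ω n → ℝ} {G : ∀ n, Ω n → SimpleGraph (Fin n)}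

lemma measurable_integral_configMeasure_edgeProb {n : ℕ} (g : (Sym2 (Fin n) → Bool) → ℂ) :
    Measurable fun w : Fin n → ℝ => ∫ c, g c ∂configMeasure (edgeProb w) := by
  simp_rw [integral_configMeasure]
  have hm : ∀ e, Measurable fun w : Fin n → ℝ => ((edgeProb w e : ℝ) : ℂ) := fun e =>
    Complex.measurable_ofReal.comp (measurable_subtype_coe.comp (measurable_edgeProb e))
  refine Finset.measurable_sum _ fun c _ => (Finset.measurable_prod _ fun e _ => ?_).mul_const _
  split_ifs
  · exact hm e
  · exact (hm e).const_sub 1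

/-- Convergence of the cycle generating functions. The law of the weights in the `n`-th graph is
realised by the first `n` terms of a single i.i.d. sequence, to which the strong law applies. -/
lemma tendsto_integral_prod_edgeConfig [IsProbabilityMeasure P₀] (hW_meas : AEMeasurable W₀ P₀)
    (hW_pos : ∀ᵐ ω ∂P₀, 0 < W₀ ω) (hW_sq : Integrable (fun ω => W₀ ω ^ 2) P₀)
    (hG : ∀ n, IsGeneralisedRandomGraph W₀ P₀ (w n) (G n) (P n)) (A : Finset CycleLength)
    (t : CycleLength → ℂ) (ht : ∀ k, ‖1 - t k‖ ≤ 1) :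
    Tendsto (fun n => ∫ ω, ∏ j ∈ cycleLabels A n,
        (1 - t j.1 * allOpen (cycleEdges j.2) (edgeConfig (G n ω))) ∂P n) atTop
      (𝓝 (Complex.exp (-∑ k ∈ A, t k * (cycleRate W₀ P₀ k : ℂ)))) := by
  set μ : Measure ℝ := P₀.map W₀ with hμ
  have : IsProbabilityMeasure μ := Measure.isProbabilityMeasure_map hW_meas
  have hW_int : Integrable W₀ P₀ :=
    ((memLp_two_iff_integrable_sq hW_meas.aestronglyMeasurable).2 hW_sq).integrable one_le_two
  set g : ∀ n, (Sym2 (Fin n) → Bool) → ℂ := fun n c =>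
    ∏ j ∈ cycleLabels A n, (1 - t j.1 * allOpen (cycleEdges j.2) c) with hg
  set F : ∀ n, (Fin n → ℝ) → ℂ := fun n w => ∫ c, g n c ∂configMeasure (edgeProb w) with hF
  have hFm : ∀ n, Measurable (F n) := fun n => measurable_integral_configMeasure_edgeProb (g n)
  have h1 : ∀ n, ∫ ω, g n (edgeConfig (G n ω)) ∂P n
      = ∫ X, F n (fun v : Fin n => X v) ∂Measure.infinitePi fun _ : ℕ => μ := by
    intro n
    have hm1 : Measurable fun ω l => w n l ω :=
      measurable_pi_lambda _ fun l => (hG n).measurable_weight l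
    have hm2 : Measurable fun (X : ℕ → ℝ) (v : Fin n) => X v :=
      measurable_pi_lambda _ fun v => measurable_pi_apply (v : ℕ)
    rw [(hG n).integral_comp_edgeConfig hW_pos (g n),
      ← integral_map (φ := fun ω l => w n l ω) (f := F n) hm1.aemeasurable
        (hFm n).aestronglyMeasurable,
      ← integral_map (φ := fun (X : ℕ → ℝ) (v : Fin n) => X v) (f := F n) hm2.aemeasurable
        (hFm n).aestronglyMeasurable, (hG n).map_weight_eq, map_infinitePi_fin]
  have hmean : ∫ x, x ∂μ = ∫ ω, W₀ ω ∂P₀ :=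
    integral_map hW_meas measurable_id.aestronglyMeasurable
  have hsq : ∫ x, x ^ 2 ∂μ = ∫ ω, W₀ ω ^ 2 ∂P₀ :=
    integral_map hW_meas (by fun_prop)
  have hs₁ : 0 < ∫ ω, W₀ ω ∂P₀ := by
    rw [integral_pos_iff_support_of_nonneg_ae (hW_pos.mono fun ω h => h.le) hW_int]
    have : ∀ᵐ ω ∂P₀, ω ∈ Function.support W₀ := hW_pos.mono fun ω h => h.ne'
    have h3 : P₀ (Function.support W₀) = P₀ Set.univ :=
      measure_congr (Filter.eventuallyEq_univ.2 this)
    rw [h3, measure_univ]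
    exact zero_lt_one
  have hlim : ∀ᵐ X ∂Measure.infinitePi fun _ : ℕ => μ,
      Tendsto (fun n => F n (fun v : Fin n => X v)) atTop
        (𝓝 (Complex.exp (-∑ k ∈ A, t k * (cycleRate W₀ P₀ k : ℂ)))) := by
    have hpos : ∀ᵐ X ∂Measure.infinitePi fun _ : ℕ => μ, ∀ i, 0 < X i := by
      refine ae_all_iff.2 fun i => ?_
      have h2 : ∀ᵐ x ∂μ, 0 < x := (ae_map_iff hW_meas measurableSet_Ioi).2 hW_pos
      rw [← Measure.infinitePi_map_eval (fun _ : ℕ => μ) i] at h2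
      exact ae_of_ae_map (measurable_pi_apply i).aemeasurable h2
    have hl1 := ae_tendsto_average_infinitePi μ (f := fun x => x) measurable_id
      ((integrable_map_measure measurable_id.aestronglyMeasurable hW_meas).2 hW_int)
    have hl2 := ae_tendsto_average_infinitePi μ (f := fun x => x ^ 2) (by fun_prop)
      ((integrable_map_measure (by fun_prop) hW_meas).2 hW_sq)
    filter_upwards [hpos, hl1, hl2] with X hX hX1 hX2
    rw [hmean] at hX1
    rw [hsq] at hX2
    exact tendsto_integral_prod_cycleLabels_of_averages hX hs₁ hX1 hX2 A t ht
  have hbound : ∀ n v, ‖F n v‖ ≤ 1 := by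
    intro n v
    refine (norm_integral_le_of_norm_le_const (C := 1) (ae_of_all _ fun c => ?_)).trans (by simp)
    refine norm_prod_le_one_of_norm_le_one _ _ fun j _ => ?_
    rcases allOpen_eq_zero_or_one (cycleEdges j.2) c with h | h <;> simp [h, ht j.1]
  change Tendsto (fun n => ∫ ω, g n (edgeConfig (G n ω)) ∂P n) atTop _
  simp_rw [h1]
  have := tendsto_integral_of_dominated_convergence (μ := Measure.infinitePi fun _ : ℕ => μ)
    (F := fun n X => F n (fun v : Fin n => X v))
    (f := fun _ => Complex.exp (-∑ k ∈ A, t k * (cycleRate W₀ P₀ k : ℂ))) (fun _ => 1)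
    (fun n => ((hFm n).comp (measurable_pi_lambda _ fun v =>
      measurable_pi_apply (v : ℕ))).aestronglyMeasurable)
    (integrable_const 1) (fun n => ae_of_all _ fun X => hbound n _) hlim
  simpa using this

end Weights

/-! ### Convergence of the cycle counts -/

lemma allOpen_cycleEdges_edgeConfig {n k : ℕ} (G : SimpleGraph (Fin n)) (α : Fin k → Fin n)
    [Decidable (∀ i, G.Adj (α i) (α (finRotate k i)))] :
    allOpen (cycleEdges α) (edgeConfig G)
      = if ∀ i, G.Adj (α i) (α (finRotate k i)) then 1 else 0 := by
  classical
  rw [allOpen_eq_ite]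
  have : (∀ e ∈ cycleEdges α, edgeConfig G e = true) ↔
      ∀ i, G.Adj (α i) (α (finRotate k i)) := by
    simp [cycleEdges, edgeConfig]
  simp only [this]

/-- The product of the factors of all possible cycles is the generating function of the cycle
counts. -/
lemma prod_cycleLabels_eq_prod_pow (A : Finset CycleLength) {n : ℕ} (G : SimpleGraph (Fin n))
    (t : CycleLength → ℂ) :
    ∏ j ∈ cycleLabels A n, (1 - t j.1 * allOpen (cycleEdges j.2) (edgeConfig G))
      = ∏ k ∈ A, (1 - t k) ^ cycleCount G k := by
  classical
  rw [cycleLabels, Finset.prod_sigma]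
  refine Finset.prod_congr rfl fun k _ => ?_
  have h : cycleCount G k = ((Finset.univ.filter fun α : Fin k → Fin n => IsCycleLabel k α).filter
      fun α => ∀ i, G.Adj (α i) (α (finRotate k i))).card := by
    rw [cycleCount, Finset.filter_filter]
  rw [h, ← Finset.prod_const, Finset.prod_filter (s := Finset.univ.filter _)]
  refine Finset.prod_congr rfl fun α _ => ?_
  rw [allOpen_cycleEdges_edgeConfig]
  split_ifs <;> simp

/-- The embedding of the lattice of counts into Euclidean space. -/
noncomputable def countsToEuclidean (A : Finset CycleLength) (c : A → ℕ) : EuclideanSpace ℝ A :=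
  WithLp.toLp 2 fun k => (c k : ℝ)

lemma isInducing_countsToEuclidean (A : Finset CycleLength) :
    IsInducing (countsToEuclidean A) := by
  have h1 : IsInducing fun (c : A → ℕ) (k : A) => (c k : ℝ) :=
    IsInducing.piMap fun _ => Nat.isClosedEmbedding_coe_real.isInducing
  exact (PiLp.homeomorph 2 fun _ : A => ℝ).symm.isInducing.comp h1

lemma charFun_poisson_pi (A : Finset CycleLength) (r : CycleLength → NNReal)
    (θ : EuclideanSpace ℝ A) :
    charFun ((Measure.pi fun k : A => poissonMeasure (r k)).map (countsToEuclidean A)) θ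
      = Complex.exp (-∑ k : A, (1 - Complex.exp (θ k * Complex.I)) * ((r k : ℝ) : ℂ)) := by
  have h1 : (Measure.pi fun k : A => poissonMeasure (r k)).map (countsToEuclidean A)
      = (Measure.pi fun k : A => (poissonMeasure (r k)).map (Nat.cast : ℕ → ℝ)).map
          (WithLp.toLp 2) := by
    rw [← Measure.pi_map_pi fun k => Measurable.of_discrete.aemeasurable, Measure.map_map]
    · rfl
    · fun_prop
    · fun_prop
  rw [h1, charFun_pi]
  simp_rw [charFun_map_cast_poissonMeasure]
  rw [← Complex.exp_sum, ← Finset.sum_neg_distrib]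
  congr 1
  refine Finset.sum_congr rfl fun k _ => ?_
  ring

lemma charFun_map_countsToEuclidean {Ω : Type*} [MeasurableSpace Ω] (P : Measure Ω)
    (A : Finset CycleLength) {C : Ω → CycleLength → ℕ}
    (hC : Measurable fun ω (k : A) => C ω k) (θ : EuclideanSpace ℝ A) :
    charFun ((P.map fun ω (k : A) => C ω k).map (countsToEuclidean A)) θ
      = ∫ ω, ∏ k : A, Complex.exp (θ k * Complex.I) ^ C ω k ∂P := by
  have hm : Measurable (countsToEuclidean A) :=
    (isInducing_countsToEuclidean A).continuous.measurable
  rw [Measure.map_map hm hC, charFun_apply, integral_map (hm.comp hC).aemeasurable (by fun_prop)]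
  refine integral_congr_ae (ae_of_all _ fun ω => ?_)
  simp only [Function.comp_apply, countsToEuclidean, PiLp.inner_apply]
  push_cast
  rw [Finset.sum_mul, Complex.exp_sum]
  refine Finset.prod_congr rfl fun k _ => ?_
  rw [← Complex.exp_nat_mul]
  congr 1
  simp
  ring

section Convergence

variable {Ω₀ : Type*} [MeasurableSpace Ω₀] {W₀ : Ω₀ → ℝ} {P₀ : Measure Ω₀}
  {Ω : ℕ → Type*} [∀ n, MeasurableSpace (Ω n)] {P : ∀ n, Measure (Ω n)}
  [∀ n, IsProbabilityMeasure (P n)] {w : ∀ n, Fin n → Ω n → ℝ} {G : ∀ n, Ω n → SimpleGraph (Fin n)}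

lemma cycleRate_nonneg (hW_pos : ∀ᵐ ω ∂P₀, 0 < W₀ ω) (k : CycleLength) :
    0 ≤ cycleRate W₀ P₀ k := by
  have h1 : 0 ≤ ∫ ω, W₀ ω ∂P₀ := integral_nonneg_of_ae (hW_pos.mono fun ω h => h.le)
  have h2 : 0 ≤ ∫ ω, W₀ ω ^ 2 ∂P₀ := integral_nonneg fun ω => sq_nonneg _
  unfold cycleRate
  positivity

/-- The cycle counts converge jointly to independent Poisson variables. -/
lemma tendstoInDistribution_cycleCount [IsProbabilityMeasure P₀] (hW_meas : AEMeasurable W₀ P₀)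
    (hW_pos : ∀ᵐ ω ∂P₀, 0 < W₀ ω) (hW_sq : Integrable (fun ω => W₀ ω ^ 2) P₀)
    (hG : ∀ n, IsGeneralisedRandomGraph W₀ P₀ (w n) (G n) (P n)) (A : Finset CycleLength) :
    TendstoInDistribution (fun n ω (k : A) => cycleCount (G n ω) k) atTop
      (id : (A → ℕ) → (A → ℕ)) P
      (Measure.pi fun k : A => poissonMeasure (cycleRate W₀ P₀ k).toNNReal) := by
  have hmeas : ∀ n, Measurable fun ω (k : A) => cycleCount (G n ω) k := fun n =>
    (hG n).measurable_comp fun H (k : A) => cycleCount H k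
  have hm : Measurable (countsToEuclidean A) :=
    (isInducing_countsToEuclidean A).continuous.measurable
  set ν := Measure.pi fun k : A => poissonMeasure (cycleRate W₀ P₀ k).toNNReal with hν
  have hpn : ∀ n, IsProbabilityMeasure ((P n).map fun ω (k : A) => cycleCount (G n ω) k) :=
    fun n => Measure.isProbabilityMeasure_map (hmeas n).aemeasurable
  let μs : ℕ → ProbabilityMeasure (EuclideanSpace ℝ A) := fun n =>
    ⟨((P n).map fun ω (k : A) => cycleCount (G n ω) k).map (countsToEuclidean A),
      Measure.isProbabilityMeasure_map hm.aemeasurable⟩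
  let μ : ProbabilityMeasure (EuclideanSpace ℝ A) :=
    ⟨ν.map (countsToEuclidean A), Measure.isProbabilityMeasure_map hm.aemeasurable⟩
  have hlim : Tendsto μs atTop (𝓝 μ) := by
    refine ProbabilityMeasure.tendsto_of_tendsto_charFun fun θ => ?_
    let t : CycleLength → ℂ := fun k =>
      if h : k ∈ A then 1 - Complex.exp (θ ⟨k, h⟩ * Complex.I) else 0
    have ht : ∀ k : A, t k = 1 - Complex.exp (θ k * Complex.I) := fun k => by simp [t]
    have h1 := tendsto_integral_prod_edgeConfig hW_meas hW_pos hW_sq hG A t fun k => by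
      by_cases hk : k ∈ A
      · simp [t, hk, Complex.norm_exp_ofReal_mul_I]
      · simp [t, hk]
    have h2 : ∀ n, charFun (μs n : Measure (EuclideanSpace ℝ A)) θ
        = ∫ ω, ∏ j ∈ cycleLabels A n,
            (1 - t j.1 * allOpen (cycleEdges j.2) (edgeConfig (G n ω))) ∂P n := by
      intro n
      refine (charFun_map_countsToEuclidean (P n) A (hmeas n) θ).trans ?_
      refine integral_congr_ae (ae_of_all _ fun ω => ?_)
      simp only
      rw [prod_cycleLabels_eq_prod_pow, ← Finset.prod_coe_sort A]
      refine Finset.prod_congr rfl fun k _ => ?_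
      rw [ht k, sub_sub_cancel]
    have h3 : charFun (μ : Measure (EuclideanSpace ℝ A)) θ
        = Complex.exp (-∑ k ∈ A, t k * (cycleRate W₀ P₀ k : ℂ)) := by
      refine (charFun_poisson_pi A (fun k => (cycleRate W₀ P₀ k).toNNReal) θ).trans ?_
      rw [← Finset.sum_coe_sort A]
      congr 2
      refine Finset.sum_congr rfl fun k _ => ?_
      rw [ht k, Real.coe_toNNReal _ (cycleRate_nonneg hW_pos k)]
    rw [h3]
    exact h1.congr fun n => (h2 n).symm
  refine ⟨fun n => (hmeas n).aemeasurable, aemeasurable_id, ?_⟩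
  refine tendsto_of_forall_isOpen_le_liminf' fun V hV => ?_
  obtain ⟨U, hU, rfl⟩ := (isInducing_countsToEuclidean A).isOpen_iff.1 hV
  have h4 := ProbabilityMeasure.le_liminf_measure_open_of_tendsto hlim hU
  simp only [μ, μs, ProbabilityMeasure.coe_mk, Measure.map_apply hm hU.measurableSet] at h4
  simpa only [ProbabilityMeasure.coe_mk, Measure.map_id] using h4

end Convergence

/-! ### Convergence in the vague topology -/

namespace CountingMeasure

/-- The mass of the point `k` as a natural number. -/
noncomputable def count (μ : CountingMeasure) (k : CycleLength) : ℕ :=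
  ⌊(μ.toMeasure {k}).toReal⌋₊

lemma toMeasure_singleton (μ : CountingMeasure) (k : CycleLength) :
    μ.toMeasure {k} = μ.count k := by
  obtain ⟨m, hm⟩ := μ.integerValued {k} (Set.finite_singleton k)
  rw [count, hm]
  simp

lemma count_ofCounts (c : CycleLength → ℕ) (k : CycleLength) : (ofCounts c).count k = c k := by
  have h : (ofCounts c).toMeasure {k} = c k := by
    change Measure.sum (fun k => (c k : ℝ≥0∞) • Measure.dirac k) {k} = _
    rw [Measure.sum_apply _ (MeasurableSet.of_discrete), tsum_eq_single k]
    · simp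
    · intro b hb; simp [hb]
  rw [count, h]
  simp

/-- A vaguely open set contains, with every counting measure, all those which have the same masses
up to some length: test functions only see a finite set of lengths. -/
lemma exists_forall_count_eq_mem_of_isOpen {U : Set CountingMeasure} (hU : IsOpen U)
    {μ : CountingMeasure} (hμ : μ ∈ U) :
    ∃ m : ℕ, ∀ μ' : CountingMeasure, (∀ k : CycleLength, (k : ℕ) < m → μ'.count k = μ.count k) →
      μ' ∈ U := by
  obtain ⟨V, hV, rfl⟩ := isOpen_induced_iff.1 hU
  obtain ⟨F, u, hu, hsub⟩ := isOpen_pi_iff.1 hV _ hμ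
  have hsupp : ∀ f : C_c(CycleLength, ℝ), ∃ m : ℕ, ∀ k : CycleLength, m ≤ (k : ℕ) → f k = 0 := by
    intro f
    have hfin : (tsupport f).Finite := f.hasCompactSupport.isCompact.finite_of_discrete
    refine ⟨hfin.toFinset.sup (fun k => (k : ℕ)) + 1, fun k hk => ?_⟩
    by_contra hne
    have hmem : k ∈ hfin.toFinset := hfin.mem_toFinset.2 (subset_tsupport f hne)
    have := Finset.le_sup (f := fun k : CycleLength => (k : ℕ)) hmem
    omega
  choose m hm using hsupp
  refine ⟨F.sup m, fun μ' hμ' => hsub fun f hf => ?_⟩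
  have hint : ∫ k, f k ∂μ'.toMeasure = ∫ k, f k ∂μ.toMeasure := by
    set s : Set CycleLength := {k | (k : ℕ) < m f} with hs
    have hzero : ∀ k ∉ s, f k = 0 := fun k hk => hm f k (not_lt.1 hk)
    rw [← setIntegral_eq_integral_of_forall_compl_eq_zero hzero,
      ← setIntegral_eq_integral_of_forall_compl_eq_zero (μ := μ.toMeasure) hzero]
    congr 1
    refine Measure.ext_of_singleton fun k => ?_
    rw [Measure.restrict_apply (measurableSet_singleton k),
      Measure.restrict_apply (measurableSet_singleton k)]
    by_cases hk : k ∈ s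
    · rw [Set.inter_eq_left.2 (Set.singleton_subset_iff.2 hk), toMeasure_singleton,
        toMeasure_singleton, hμ' k (lt_of_lt_of_le hk (Finset.le_sup hf))]
    · rw [Set.singleton_inter_eq_empty.2 hk, measure_empty, measure_empty]
  have := (hu f hf).2
  simp only [hint]
  exact this

end CountingMeasure

/-- The possible cycle lengths below `m`. -/
def cycleLengthsBelow (m : ℕ) : Finset CycleLength := (Finset.range m).subtype _

lemma mem_cycleLengthsBelow {m : ℕ} {k : CycleLength} : k ∈ cycleLengthsBelow m ↔ (k : ℕ) < m := by
  simp [cycleLengthsBelow]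

/-- If the masses of finitely many points always converge jointly in distribution, then the random
counting measures converge in distribution for the vague topology: every open set is an increasing
union of cylinder sets. -/
lemma tendstoInDistribution_countingMeasure {Ω : ℕ → Type*} [∀ n, MeasurableSpace (Ω n)]
    {P : ∀ n, Measure (Ω n)} [∀ n, IsProbabilityMeasure (P n)] {Ω' : Type*} [MeasurableSpace Ω']
    {P' : Measure Ω'} [IsProbabilityMeasure P'] {ξ : ∀ n, Ω n → CountingMeasure}
    {η : Ω' → CountingMeasure} (hξ : ∀ n, AEMeasurable (ξ n) (P n)) (hη : AEMeasurable η P')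
    (h : ∀ A : Finset CycleLength, TendstoInDistribution (fun n ω (k : A) => (ξ n ω).count k) atTop
      (fun ω (k : A) => (η ω).count k) P P') :
    TendstoInDistribution ξ atTop η P P' := by
  refine ⟨hξ, hη, tendsto_of_forall_isOpen_le_liminf' fun U hU => ?_⟩
  let V : ∀ m : ℕ, Set (cycleLengthsBelow m → ℕ) := fun m =>
    {c | ∀ μ : CountingMeasure, (∀ k : cycleLengthsBelow m, μ.count k = c k) → μ ∈ U}
  let S : ℕ → Set CountingMeasure := fun m =>
    {μ | (fun k : cycleLengthsBelow m => μ.count k) ∈ V m}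
  have hSU : ∀ m, S m ⊆ U := fun m μ hμ => hμ μ fun k => rfl
  have hmono : Monotone S := by
    intro m m' hmm μ hμ μ' hμ'
    refine hμ μ' fun k => hμ' ⟨k, ?_⟩
    exact mem_cycleLengthsBelow.2 ((mem_cycleLengthsBelow.1 k.2).trans_le hmm)
  have hUnion : U = ⋃ m, S m := by
    refine subset_antisymm (fun μ hμ => ?_) (Set.iUnion_subset hSU)
    obtain ⟨m, hm⟩ := CountingMeasure.exists_forall_count_eq_mem_of_isOpen hU hμ
    exact Set.mem_iUnion.2 ⟨m, fun μ' hμ' => hm μ' fun k hk =>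
      hμ' ⟨k, mem_cycleLengthsBelow.2 hk⟩⟩
  simp only [ProbabilityMeasure.coe_mk]
  rw [Measure.map_apply_of_aemeasurable hη hU.measurableSet]
  simp_rw [fun n => Measure.map_apply_of_aemeasurable (hξ n) hU.measurableSet]
  have hpre : η ⁻¹' U = ⋃ m, η ⁻¹' S m := by rw [hUnion, Set.preimage_iUnion]
  rw [hpre, Monotone.measure_iUnion fun m m' hmm => Set.preimage_mono (hmono hmm)]
  refine iSup_le fun m => ?_
  have hm := h (cycleLengthsBelow m)
  have h1 := ProbabilityMeasure.le_liminf_measure_open_of_tendsto hm.tendsto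
    (isOpen_discrete (V m))
  simp only [ProbabilityMeasure.coe_mk] at h1
  rw [Measure.map_apply_of_aemeasurable hm.aemeasurable_limit MeasurableSet.of_discrete] at h1
  simp_rw [fun n => Measure.map_apply_of_aemeasurable (hm.forall_aemeasurable n)
    (MeasurableSet.of_discrete (s := V m))] at h1
  refine h1.trans (liminf_le_liminf (Eventually.of_forall fun n => measure_mono ?_))
  exact fun ω hω => hSU m hω

lemma cycleIntensity_singleton {Ω₀ : Type*} [MeasurableSpace Ω₀] (W₀ : Ω₀ → ℝ) (P₀ : Measure Ω₀)
    (k : CycleLength) : cycleIntensity W₀ P₀ {k} = ENNReal.ofReal (cycleRate W₀ P₀ k) := by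
  rw [cycleIntensity, Measure.sum_apply _ (MeasurableSet.of_discrete), tsum_eq_single k]
  · simp
  · intro b hb; simp [hb]

/-- The masses of finitely many points under a Poisson point process are independent Poisson
variables. -/
lemma IsPoissonPointProcess.map_count {Ω' : Type*} [MeasurableSpace Ω'] {η : Ω' → CountingMeasure}
    {Λ : Measure CycleLength} {P' : Measure Ω'} [IsProbabilityMeasure P']
    (hη : IsPoissonPointProcess η Λ P') (hΛ : ∀ k, Λ {k} ≠ ∞) (A : Finset CycleLength) :
    AEMeasurable (fun ω (k : A) => (η ω).count k) P' ∧
      P'.map (fun ω (k : A) => (η ω).count k)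
        = Measure.pi fun k : A => poissonMeasure (Λ {(k : CycleLength)}).toNNReal := by
  have hfloor : Measurable fun x : ℝ≥0∞ => ⌊x.toReal⌋₊ :=
    Nat.measurable_floor.comp ENNReal.measurable_toReal
  have hm : ∀ k : A, AEMeasurable (fun ω => (η ω).count k) P' := fun k =>
    hfloor.comp_aemeasurable (hη.hasLaw {(k : CycleLength)} (hΛ k)).aemeasurable
  refine ⟨aemeasurable_pi_iff.2 hm, ?_⟩
  have hind : iIndepFun (fun (k : A) ω => (η ω).count k) P' := by
    have h1 := hη.indep A.card (fun i => {((A.equivFin.symm i : A) : CycleLength)})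
        fun i j hij => by
      refine Set.disjoint_singleton.2 fun h => hij ?_
      exact A.equivFin.symm.injective (Subtype.ext h)
    have h2 := (h1.comp (fun _ x => ⌊x.toReal⌋₊) fun _ => hfloor).precomp A.equivFin.injective
    convert h2 using 2 with k
    ext ω
    simp [CountingMeasure.count]
  rw [(iIndepFun_iff_map_fun_eq_pi_map hm).1 hind]
  congr 1
  ext1 k
  have h3 := hη.hasLaw {(k : CycleLength)} (hΛ k)
  have h4 := AEMeasurable.map_map_of_aemeasurable (μ := P') (g := fun x : ℝ≥0∞ => ⌊x.toReal⌋₊)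
    hfloor.aemeasurable h3.aemeasurable
  rw [h3.map_eq, Measure.map_map hfloor (by fun_prop)] at h4
  have h5 : ((fun x : ℝ≥0∞ => ⌊x.toReal⌋₊) ∘ (Nat.cast : ℕ → ℝ≥0∞)) = id := by ext n; simp
  rw [h5, Measure.map_id] at h4
  exact h4.symm

theorem theorem2p1 {Ω₀ : Type*} [MeasurableSpace Ω₀] (P₀ : Measure Ω₀) [IsProbabilityMeasure P₀]
    (W₀ : Ω₀ → ℝ) (hW_meas : AEMeasurable W₀ P₀) (hW_pos : ∀ᵐ ω ∂P₀, 0 < W₀ ω)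
    (hW_sq : Integrable (fun ω => W₀ ω ^ 2) P₀)
    {Ω : ℕ → Type*} [∀ n, MeasurableSpace (Ω n)] (P : ∀ n, Measure (Ω n))
    [∀ n, IsProbabilityMeasure (P n)]
    (w : ∀ n, Fin n → Ω n → ℝ) (G : ∀ n, Ω n → SimpleGraph (Fin n))
    (hG : ∀ n, IsGeneralisedRandomGraph W₀ P₀ (w n) (G n) (P n)) :
    (∀ {Ω' : Type*} [MeasurableSpace Ω'] (P' : Measure Ω') [IsProbabilityMeasure P']
        (η : Ω' → CountingMeasure), IsPoissonPointProcess η (cycleIntensity W₀ P₀) P' →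
      TendstoInDistribution (fun n ω => cycleProcess (G n ω)) atTop η P P') ∧
    (∀ A : Finset CycleLength,
      TendstoInDistribution (fun n ω (k : A) => cycleCount (G n ω) k) atTop
        (id : (A → ℕ) → (A → ℕ)) P
        (Measure.pi fun k : A => poissonMeasure (cycleRate W₀ P₀ k).toNNReal)) := by
  refine ⟨fun P' _ η hη => ?_, tendstoInDistribution_cycleCount hW_meas hW_pos hW_sq hG⟩
  refine tendstoInDistribution_countingMeasure
    (fun n => ((hG n).measurable_comp cycleProcess).aemeasurable) hη.aemeasurable fun A => ?_
  have hc := tendstoInDistribution_cycleCount hW_meas hW_pos hW_sq hG A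
  obtain ⟨hm, hlaw⟩ := hη.map_count (fun k => by
    rw [cycleIntensity_singleton]; exact ENNReal.ofReal_ne_top) A
  have hcount : ∀ n ω k, (cycleProcess (G n ω)).count k = cycleCount (G n ω) k := fun n ω k =>
    CountingMeasure.count_ofCounts _ k
  simp_rw [cycleIntensity_singleton] at hlaw
  simp_rw [hcount]
  refine ⟨hc.forall_aemeasurable, hm, ?_⟩
  convert hc.tendsto using 2
  exact congrArg 𝓝 (Subtype.ext (hlaw.trans Measure.map_id.symm))
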